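/- **Setting.** Let $G=(S,E)$ be a finite directed graph with edge costs $\mathbf{cost}=(cost_1,cost_2):E\to\mathbb R_{\ge0}^2$, let $start,goal\in S$ and $W\ge 0$. The cost of a path (a sequence of states in which consecutive states are joined by edges) is the sum of its edge costs. A start-goal path is *feasible* if its $cost_2$ is at most $W$, and *cost-optimal* if it is feasible and its pair $(cost_1,cost_2)$ is lexicographically smallest among all feasible start-goal paths. The forward direction $f$ goes from $start$ to $goal$ in $G$; the backward direction $b$ goes from $goal$ to $start$ in the reversed graph. For a direction $d$, $d'$ is the opposite one. The forward search has primary and secondary attributes $(p,s)=(1,2)$, the backward search $(p,s)=(2,1)$. **Initialisation of WC-BA\*.** Set $\overline f_2=W$ and $\overline f_1=\infty$ (shared). A *bounded A\** on $cost_p$ in direction $d$ with heuristic $e$ keeps for each reached state the lexicographically smallest $(g_p,g_s)$ found, where $s$ is the other attribute; it repeatedly expands an unexpanded reached state with smallest $(g_p+e,g_s)$, and stops when none is left or when $g_p+e>\overline f_p$ for that state. * *Round one*, two searches in parallel: a backward one on $cost_2$, giving $(h^f_2,ub^f_1)=(g_2,g_1)$ at expanded states and setting $\overline f_1\leftarrow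 g_1$ when $start$ is expanded; and a forward one on $cost_1$, giving $(h^b_1,ub^b_2)=(g_1,g_2)$. They use given heuristics (e.g. $0$) that are admissible and consistent for their targets. * *Round two*, when both are complete, two searches in parallel, restricted to the states expanded by both searches of round one: a forward one on $cost_2$ with heuristic $h^f_2$, giving $(h^b_2,ub^b_1)=(g_2,g_1)$; and a backward one on $cost_1$ with heuristic $h^b_1$, giving $(h^f_1,ub^f_2)=(g_1,g_2)$. Whenever one of them expands a state, its path is joined with the path found for this state by the round-one search on the same attribute, and if the joined path has $cost_2\le W$, then $\overline f_1$ is lowered to its $cost_1$ if that is smaller. All these values are $\infty$ at states that the respective search does not expand. **Constrained search.** Set $Sol=(\varnothing,\varnothing)$, $f^{sol}_2=\infty$. Each direction $d$ has $g^d_{min}\equiv\infty$ and a queue $Open^d$ containing one node at its initial state with $\mathbf g=(0,0)$. Each node $x$ stores its state $s(x)$, its parent, $\mathbf g(x)$, and $\mathbf f(x)=\mathbf g(x)+\mathbf h^d(s(x))$ as computed when it is generated. The two searches run in parallel with shared $\mathbf h,\mathbf{ub},\overline{\mathbf f},f_2^{sol},Sol$; their iterations are atomic and interleaved in an arbitrary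 way. One iteration in direction $d$, with $u=s(x)$: 1. If $Open^d=\emptyset$, this search is complete. Otherwise remove from $Open^d$ a node $x$ with lexicographically smallest $(f_p,f_s)$ (ties arbitrary). If $f_p(x)>\overline f_p$, this search is complete. 2. If $d=b$ and $f_1(x)>\overline f_1$, or if $g_s(x)\ge g^d_{min}(u)$, the iteration ends. 3. (HTF) If $g^d_{min}(u)=\infty$, set $h^{d'}_p(u)\leftarrow g_p(x)$ and $ub^{d'}_s(u)\leftarrow g_s(x)$. Then set $g^d_{min}(u)\leftarrow g_s(x)$. 4. (Early solution update) With the current values put $\mathbf a=\mathbf g(x)+\mathbf h^d(u)$ and $\mathbf c=\mathbf g(x)+\mathbf{ub}^d(u)$. * $d=f$: if $c_2\le W$, then if $a_1<\overline f_1$ or $c_2<f^{sol}_2$ set $(\overline f_1,f_2^{sol},Sol)\leftarrow(a_1,c_2,(x,\varnothing))$; otherwise (if $c_2>W$), if $a_2\le W$ and $c_1<\overline f_1$ set $(\overline f_1,f_2^{sol})\leftarrow(c_1,\infty)$. * $d=b$: if $c_1\le\overline f_1$, then if $c_1<\overline f_1$ or $a_2<f^{sol}_2$ set $(\overline f_1,f_2^{sol},Sol)\leftarrow(c_1,a_2,(\varnothing,x))$;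 otherwise (if $c_1>\overline f_1$), if $c_2\le W$ and $a_1<\overline f_1$ set $(\overline f_1,f_2^{sol})\leftarrow(a_1,\infty)$. 5. If $h^d_p(u)=ub^d_p(u)$, the iteration ends. Otherwise, for every successor $v$ of $u$ in direction $d$, generate the node $y$ with state $v$, parent $x$ and $\mathbf g(y)=\mathbf g(x)+\mathbf{cost}$ of the edge, and add it to $Open^d$ if $g_s(y)<g^d_{min}(v)$, $\mathbf g(y)\preceq\mathbf{ub}^{d'}(v)$ and $\mathbf f(y)\preceq\overline{\mathbf f}$ (componentwise). As soon as one of the two searches is complete, WC-BA\* stops and returns $Sol$. The path corresponding to a solution node $x$ of direction $d$ is the path given by its chain of parents joined with the path from $s(x)$ to the target of $d$ that round two found on the primary attribute of $d$ (the path behind the initial $h^d_p$). **Theorem.** For every instance, under every interleaving of the parallel searches and every choice among ties, WC-BA\* terminates. If a feasible start-goal path exists, the returned $Sol$ contains exactly one node, and the path corresponding to it is a cost-optimal start-goal path. If no feasible path exists, $Sol=(\varnothing,\varnothing)$ is returned. -/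

import Mathlib

open scoped NNReal ENNReal

noncomputable section

namespace WCSPP

/-- The two search directions. -/
inductive Dir
  | fwd
  | bwd
  deriving DecidableEq

/-- The opposite direction. -/
def Dir.opp : Dir → Dir
  | .fwd => .bwd
  | .bwd => .fwd

/-- The primary attribute of the constrained search in a direction. Attribute `0` is `cost₁`,
attribute `1` is `cost₂`; the forward search is in the `(f₁, f₂)` order, the backward search in
the `(f₂, f₁)` order. -/
def Dir.pri : Dir → Fin 2
  | .fwd => 0
  | .bwd => 1

/-- The secondary attribute of the constrained search in a direction. -/
def Dir.sec : Dir → Fin 2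
  | .fwd => 1
  | .bwd => 0

/-- The attribute other than `i`. -/
def other (i : Fin 2) : Fin 2 := if i = 0 then 1 else 0

/-- A problem instance: a directed graph whose edges carry two non-negative attributes
(`cost` is only relevant on edges), a start state, a goal state and the weight limit. -/
structure Instance (S : Type*) where
  edge : S → S → Prop
  cost : S → S → Fin 2 → ℝ≥0
  start : S
  goal : S
  W : ℝ≥0

section Paths

variable {S : Type*} (P : Instance S)

/-- The edges of the graph (forward) or of the reversed graph (backward). -/
def Instance.arc : Dir → S → S → Prop
  | .fwd => fun u v => P.edge u v
  | .bwd => fun u v => P.edge v u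

/-- The costs of the edges of the graph (forward) or of the reversed graph (backward). -/
def Instance.arcCost : Dir → S → S → Fin 2 → ℝ≥0
  | .fwd => fun u v => P.cost u v
  | .bwd => fun u v => P.cost v u

/-- The initial state of a search direction. -/
def Instance.initial : Dir → S
  | .fwd => P.start
  | .bwd => P.goal

/-- The target state of a search direction. -/
def Instance.target (d : Dir) : S := P.initial d.opp

/-- The sequence of states `π` is a path from `u` to `v` in direction `d`. -/
def Instance.IsPath (d : Dir) (u v : S) (π : List S) : Prop :=
  π.head? = some u ∧ π.getLast? = some v ∧ π.IsChain (P.arc d)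

/-- The cost of a sequence of states: the sum of the costs of its edges. -/
def Instance.pathCost (d : Dir) : List S → Fin 2 → ℝ≥0
  | [] => 0
  | [_] => 0
  | u :: v :: π => P.arcCost d u v + Instance.pathCost d (v :: π)

/-- `π` is a start-goal path within the weight limit. -/
def Instance.IsFeasible (π : List S) : Prop :=
  P.IsPath .fwd P.start P.goal π ∧ P.pathCost .fwd π 1 ≤ P.W

/-- `π` is a cost-optimal start-goal solution path: it has the lexicographically smallest
`(cost₁, cost₂)` among all start-goal paths within the weight limit. -/
def Instance.IsCostOptimal (π : List S) : Prop :=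
  P.IsFeasible π ∧ ∀ π', P.IsFeasible π' →
    toLex (P.pathCost .fwd π 0, P.pathCost .fwd π 1) ≤
      toLex (P.pathCost .fwd π' 0, P.pathCost .fwd π' 1)

/-- `e` is an admissible and consistent heuristic on attribute `i` for searching in direction `d`,
that is, it bounds the remaining cost to the target of that direction. -/
structure Instance.IsHeuristic (d : Dir) (i : Fin 2) (e : S → ℝ≥0) : Prop where
  admissible : ∀ u π, P.IsPath d u (P.target d) π → e u ≤ P.pathCost d π i
  consistent : ∀ u v, P.arc d u v → e u ≤ P.arcCost d u v i + e v

end Paths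

/-! ### Bounded single-objective A* (the initialisation phase) -/

/-- A label of a state in a preliminary search: the cost of a path from the root of the search to
the state, and the states on it, listed from the state back to the root. -/
structure Label (S : Type*) where
  cost : Fin 2 → ℝ≥0
  path : List S

/-- A preliminary search: the best label found so far for each state, the expanded states, and
whether the search has terminated. -/
structure HSearch (S : Type*) where
  label : S → Option (Label S)
  closed : Set S
  finished : Prop

namespace HSearch

variable {S : Type*}

open scoped Classical in
/-- A search restricted to `allowed` starts with the root as its only labelled state. -/
def init (root : S) (allowed : Set S) : HSearch S where
  label u := if u = root ∧ u ∈ allowed then some ⟨0, [u]⟩ else none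
  closed := ∅
  finished := False

/-- `u` waits for expansion with label `l`. -/
def IsOpen (s : HSearch S) (u : S) (l : Label S) : Prop := s.label u = some l ∧ u ∉ s.closed

/-- The queue key: the estimate on attribute `p` under the heuristic `e`, ties being broken by the
cost on the other attribute. -/
def key (p : Fin 2) (e : S → ℝ≥0∞) (u : S) (l : Label S) : ℝ≥0∞ ×ₗ ℝ≥0∞ :=
  toLex ((l.cost p : ℝ≥0∞) + e u, (l.cost (other p) : ℝ≥0∞))

/-- `u`, with label `l`, has a smallest key among the states waiting for expansion. -/
def IsLeast (p : Fin 2) (e : S → ℝ≥0∞) (s : HSearch S) (u : S) (l : Label S) : Prop :=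
  s.IsOpen u l ∧ ∀ u' l', s.IsOpen u' l' → key p e u l ≤ key p e u' l'

/-- The running search may expand `u`: it is least and its estimate is within the bound. -/
def CanExpand (p : Fin 2) (e : S → ℝ≥0∞) (bound : ℝ≥0∞) (s : HSearch S) (u : S)
    (l : Label S) : Prop :=
  ¬ s.finished ∧ s.IsLeast p e u l ∧ (l.cost p : ℝ≥0∞) + e u ≤ bound

/-- The running search terminates: nothing is left, or the least state is out of bounds. -/
def CanFinish (p : Fin 2) (e : S → ℝ≥0∞) (bound : ℝ≥0∞) (s : HSearch S) : Prop :=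
  ¬ s.finished ∧ ((∀ u l, ¬ s.IsOpen u l) ∨
    ∃ u l, s.IsLeast p e u l ∧ bound < (l.cost p : ℝ≥0∞) + e u)

open scoped Classical in
/-- Expand `u` (with label `l`) in direction `d`: close it and relabel the allowed unexpanded
successors which are reached by a path lexicographically smaller in the `(p, other p)` order. -/
def expand (P : Instance S) (d : Dir) (p : Fin 2) (allowed : Set S) (s : HSearch S) (u : S)
    (l : Label S) : HSearch S where
  label v :=
    let new : Label S := ⟨l.cost + P.arcCost d u v, v :: l.path⟩
    if P.arc d u v ∧ v ∈ allowed ∧ v ∉ insert u s.closed ∧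
        ∀ old, s.label v = some old →
          toLex (new.cost p, new.cost (other p)) < toLex (old.cost p, old.cost (other p))
    then some new else s.label v
  closed := insert u s.closed
  finished := s.finished

/-- Mark the search as terminated. -/
def finish (s : HSearch S) : HSearch S := { s with finished := True }

open scoped Classical in
/-- The cost on attribute `i` of the path found to an expanded state, `∞` at unexpanded states. -/
def value (s : HSearch S) (i : Fin 2) (u : S) : ℝ≥0∞ :=
  if u ∈ s.closed then (s.label u).elim ⊤ (fun l => (l.cost i : ℝ≥0∞)) else ⊤

/-- The path found, listed from the state to the root of the search. -/
def route (s : HSearch S) (u : S) : List S := (s.label u).elim [] Label.path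

end HSearch

/-- Round one of the initialisation: a backward search on `cost₂`, a forward search on `cost₁`,
and the shared upper bound on `cost₁`. -/
structure Round1 (S : Type*) where
  back2 : HSearch S
  fwd1 : HSearch S
  fbar1 : ℝ≥0∞

/-- Round two: a forward search on `cost₂` and a backward search on `cost₁`, with the results of
round one (`r.fbar1` is still the shared upper bound on `cost₁`). -/
structure Round2 (S : Type*) where
  r : Round1 S
  fwd2 : HSearch S
  back1 : HSearch S

namespace Round2

variable {S : Type*}

/-- Round two ignores the states which were not expanded by both searches of round one. -/
def allowed (r : Round1 S) : Set S := r.back2.closed ∩ r.fwd1.closed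

open scoped Classical in
/-- Path matching: join the path labelled `l` at `u` with the path found for `u` by the search `s`
of round one; if the joined path is within the weight limit, it may decrease the bound. -/
def matching (P : Instance S) (s : HSearch S) (u : S) (l : Label S) (fbar1 : ℝ≥0∞) : ℝ≥0∞ :=
  if (l.cost 1 : ℝ≥0∞) + s.value 1 u ≤ (P.W : ℝ≥0∞) then
    min fbar1 ((l.cost 0 : ℝ≥0∞) + s.value 0 u)
  else fbar1

end Round2

/-! ### The constrained search -/

/-- A search node: its state, the states of its successive ancestors (parent first), its cost `g`
and the estimate `f` computed when it was generated. -/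
structure Node (S : Type*) where
  state : S
  anc : List S
  g : Fin 2 → ℝ≥0
  f : Fin 2 → ℝ≥0∞

/-- The data private to one constrained search: the open list, and `g_min`. -/
structure Search (S : Type*) where
  opn : Multiset (Node S)
  gmin : S → ℝ≥0∞

/-- The state of the second phase: the shared lower bounds `h` and upper bounds `ub` (indexed by
direction and attribute), the complementary primary-cost paths found in the initialisation phase,
the shared bound `fbar1`, the solution pair with its secondary cost, and the two searches. -/
structure Main (S : Type*) where
  h : Dir → Fin 2 → S → ℝ≥0∞
  ub : Dir → Fin 2 → S → ℝ≥0∞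
  comp : Dir → S → List S
  fbar1 : ℝ≥0∞
  fsol2 : ℝ≥0∞
  sol : Option (Node S) × Option (Node S)
  search : Dir → Search S

/-- What the algorithm returns: the solution pair, with the complementary paths from which the
solution path is recovered. -/
structure Output (S : Type*) where
  sol : Option (Node S) × Option (Node S)
  comp : Dir → S → List S

namespace Main

variable {S : Type*}

/-- The global upper bounds. -/
def fbar (P : Instance S) (M : Main S) (i : Fin 2) : ℝ≥0∞ :=
  if i = 0 then M.fbar1 else (P.W : ℝ≥0∞)

def toOutput (M : Main S) : Output S := ⟨M.sol, M.comp⟩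

/-- The beginning of the second phase: bounds from the four preliminary searches, an empty
solution, and one node per search. -/
def init (P : Instance S) (R : Round2 S) : Main S :=
  let h : Dir → Fin 2 → S → ℝ≥0∞ := fun d i => match d with
    | .fwd => if i = 0 then R.back1.value 0 else R.r.back2.value 1
    | .bwd => if i = 0 then R.r.fwd1.value 0 else R.fwd2.value 1
  let ub : Dir → Fin 2 → S → ℝ≥0∞ := fun d i => match d with
    | .fwd => if i = 0 then R.r.back2.value 0 else R.back1.value 1
    | .bwd => if i = 0 then R.fwd2.value 0 else R.r.fwd1.value 1
  { h := h
    ub := ub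
    comp := fun d => match d with
      | .fwd => R.back1.route
      | .bwd => R.fwd2.route
    fbar1 := R.r.fbar1
    fsol2 := ⊤
    sol := (none, none)
    search := fun d =>
      { opn := {⟨P.initial d, [], 0, fun i => h d i (P.initial d)⟩}
        gmin := fun _ => ⊤ } }

/-- `x` is in the open list of direction `d`, with lexicographically smallest `(f_p, f_s)`. -/
def IsLeast (M : Main S) (d : Dir) (x : Node S) : Prop :=
  x ∈ (M.search d).opn ∧ ∀ y ∈ (M.search d).opn,
    toLex (x.f d.pri, x.f d.sec) ≤ toLex (y.f d.pri, y.f d.sec)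

open scoped Classical in
/-- Remove `x` from the open list of direction `d`. -/
def pop (M : Main S) (d : Dir) (x : Node S) : Main S :=
  { M with
    search := fun d' =>
      if d' = d then { M.search d with opn := (M.search d).opn.erase x } else M.search d' }

open scoped Classical in
/-- Heuristic tuning with the first expanded path: at the first expansion of a state, the lower
bound of the opposite direction on the primary attribute and its companion upper bound on the
secondary attribute are replaced by the costs of `x`. -/
def tune (M : Main S) (d : Dir) (x : Node S) : Main S :=
  if (M.search d).gmin x.state = ⊤ then
    { M with
      h := fun d' i v =>
        if d' = d.opp ∧ i = d.pri ∧ v = x.state then (x.g d.pri : ℝ≥0∞) else M.h d' i v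
      ub := fun d' i v =>
        if d' = d.opp ∧ i = d.sec ∧ v = x.state then (x.g d.sec : ℝ≥0∞) else M.ub d' i v }
  else M

open scoped Classical in
/-- Set `g_min` of the state of `x` to the secondary cost of `x`. -/
def setGmin (M : Main S) (d : Dir) (x : Node S) : Main S :=
  { M with
    search := fun d' =>
      if d' = d then
        { M.search d with
          gmin := fun v =>
            if v = x.state then (x.g d.sec : ℝ≥0∞) else (M.search d).gmin v }
      else M.search d' }

open scoped Classical in
/-- Early solution update. `(lo 0, hi 1)` and `(hi 0, lo 1)` are the costs of the two paths obtained
by joining `x` with the path behind `(h₁, ub₂)`, respectively behind `(ub₁, h₂)`. The join with the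
path that is best in the primary attribute is a tentative solution if it is valid; if it is
not, the other join, if valid, may still decrease the upper bound on `cost₁`. -/
def esu (P : Instance S) (M : Main S) (d : Dir) (x : Node S) : Main S :=
  let lo : Fin 2 → ℝ≥0∞ := fun i => (x.g i : ℝ≥0∞) + M.h d i x.state
  let hi : Fin 2 → ℝ≥0∞ := fun i => (x.g i : ℝ≥0∞) + M.ub d i x.state
  match d with
  | .fwd =>
    if hi 1 ≤ (P.W : ℝ≥0∞) then
      if lo 0 < M.fbar1 ∨ hi 1 < M.fsol2 then
        { M with fbar1 := lo 0, fsol2 := hi 1, sol := (some x, none) }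
      else M
    else if lo 1 ≤ (P.W : ℝ≥0∞) ∧ hi 0 < M.fbar1 then
      { M with fbar1 := hi 0, fsol2 := ⊤ }
    else M
  | .bwd =>
    if hi 0 ≤ M.fbar1 then
      if hi 0 < M.fbar1 ∨ lo 1 < M.fsol2 then
        { M with fbar1 := hi 0, fsol2 := lo 1, sol := (none, some x) }
      else M
    else if hi 1 ≤ (P.W : ℝ≥0∞) ∧ lo 0 < M.fbar1 then
      { M with fbar1 := lo 0, fsol2 := ⊤ }
    else M

/-- The node obtained by extending `x` to the state `v` in direction `d`. -/
def child (P : Instance S) (M : Main S) (d : Dir) (x : Node S) (v : S) : Node S :=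
  { state := v
    anc := x.state :: x.anc
    g := x.g + P.arcCost d x.state v
    f := fun i => ((x.g i + P.arcCost d x.state v i : ℝ≥0) : ℝ≥0∞) + M.h d i v }

/-- The new node `y` is not pruned: not by the last expanded node of its state, not by the upper
bounds of its state, and not by the global upper bounds. -/
def Keep (P : Instance S) (M : Main S) (d : Dir) (y : Node S) : Prop :=
  (y.g d.sec : ℝ≥0∞) < (M.search d).gmin y.state ∧
    (∀ i, (y.g i : ℝ≥0∞) ≤ M.ub d.opp i y.state) ∧ ∀ i, y.f i ≤ M.fbar P i

open scoped Classical in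
/-- Expand and prune: add the unpruned extensions of `x` to the open list. -/
def exp [Fintype S] (P : Instance S) (M : Main S) (d : Dir) (x : Node S) : Main S :=
  { M with
    search := fun d' =>
      if d' = d then
        { M.search d with
          opn := (M.search d).opn +
            ((Finset.univ.filter (fun v : S => P.arc d x.state v ∧
              Keep P M d (child P M d x v))).val.map (child P M d x)) }
      else M.search d' }

open scoped Classical in
/-- The exploration of a node which is neither out of bounds nor weakly dominated. -/
def explore [Fintype S] (P : Instance S) (M : Main S) (d : Dir) (x : Node S) : Main S :=
  let M' := ((M.tune d x).setGmin d x).esu P d x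
  if M'.h d d.pri x.state = M'.ub d d.pri x.state then M' else M'.exp P d x

open scoped Classical in
/-- One iteration of the search in direction `d`, for the extracted node `x` with
`f_p(x)` within its bound. The test on `f_s(x)` is made in the backward search only. -/
def iterate [Fintype S] (P : Instance S) (M : Main S) (d : Dir) (x : Node S) : Main S :=
  let M' := M.pop d x
  if d = .bwd ∧ M'.fbar P d.sec < x.f d.sec then M'
  else if (M'.search d).gmin x.state ≤ (x.g d.sec : ℝ≥0∞) then M'
  else M'.explore P d x

end Main

/-! ### The whole algorithm -/

/-- The configurations of the algorithm. -/
inductive Config (S : Type*)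
  | round1 (r : Round1 S)
  | round2 (r : Round2 S)
  | main (M : Main S)
  | returned (out : Output S)

/-- The initial configuration. -/
def initConfig {S : Type*} (P : Instance S) : Config S :=
  .round1 ⟨HSearch.init P.goal Set.univ, HSearch.init P.start Set.univ, ⊤⟩

open scoped Classical in
/-- The steps of the algorithm, with heuristics `e₂` and `e₁` for the two searches of round one.
The two parallel searches of each phase are interleaved in an arbitrary way: a step is one
iteration of one of them, and an extraction may choose any least element of the queue. -/
inductive Step {S : Type*} [Fintype S] (P : Instance S) (e₁ e₂ : S → ℝ≥0) :
    Config S → Config S → Prop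
  | back2_expand (r : Round1 S) (u : S) (l : Label S)
      (hu : r.back2.CanExpand 1 (fun v => (e₂ v : ℝ≥0∞)) (P.W : ℝ≥0∞) u l) :
      Step P e₁ e₂ (.round1 r)
        (.round1 { r with
          back2 := r.back2.expand P .bwd 1 Set.univ u l
          fbar1 := if u = P.start then (l.cost 0 : ℝ≥0∞) else r.fbar1 })
  | back2_finish (r : Round1 S)
      (hr : r.back2.CanFinish 1 (fun v => (e₂ v : ℝ≥0∞)) (P.W : ℝ≥0∞)) :
      Step P e₁ e₂ (.round1 r) (.round1 { r with back2 := r.back2.finish })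
  | fwd1_expand (r : Round1 S) (u : S) (l : Label S)
      (hu : r.fwd1.CanExpand 0 (fun v => (e₁ v : ℝ≥0∞)) r.fbar1 u l) :
      Step P e₁ e₂ (.round1 r)
        (.round1 { r with fwd1 := r.fwd1.expand P .fwd 0 Set.univ u l })
  | fwd1_finish (r : Round1 S)
      (hr : r.fwd1.CanFinish 0 (fun v => (e₁ v : ℝ≥0∞)) r.fbar1) :
      Step P e₁ e₂ (.round1 r) (.round1 { r with fwd1 := r.fwd1.finish })
  | to_round2 (r : Round1 S) (hb : r.back2.finished) (hf : r.fwd1.finished) :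
      Step P e₁ e₂ (.round1 r)
        (.round2 ⟨r, HSearch.init P.start (Round2.allowed r),
          HSearch.init P.goal (Round2.allowed r)⟩)
  | fwd2_expand (R : Round2 S) (u : S) (l : Label S)
      (hu : R.fwd2.CanExpand 1 (R.r.back2.value 1) (P.W : ℝ≥0∞) u l) :
      Step P e₁ e₂ (.round2 R)
        (.round2 { R with
          r := { R.r with fbar1 := Round2.matching P R.r.back2 u l R.r.fbar1 }
          fwd2 := R.fwd2.expand P .fwd 1 (Round2.allowed R.r) u l })
  | fwd2_finish (R : Round2 S)
      (hR : R.fwd2.CanFinish 1 (R.r.back2.value 1) (P.W : ℝ≥0∞)) :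
      Step P e₁ e₂ (.round2 R) (.round2 { R with fwd2 := R.fwd2.finish })
  | back1_expand (R : Round2 S) (u : S) (l : Label S)
      (hu : R.back1.CanExpand 0 (R.r.fwd1.value 0) R.r.fbar1 u l) :
      Step P e₁ e₂ (.round2 R)
        (.round2 { R with
          r := { R.r with fbar1 := Round2.matching P R.r.fwd1 u l R.r.fbar1 }
          back1 := R.back1.expand P .bwd 0 (Round2.allowed R.r) u l })
  | back1_finish (R : Round2 S)
      (hR : R.back1.CanFinish 0 (R.r.fwd1.value 0) R.r.fbar1) :
      Step P e₁ e₂ (.round2 R) (.round2 { R with back1 := R.back1.finish })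
  | to_main (R : Round2 S) (hf : R.fwd2.finished) (hb : R.back1.finished) :
      Step P e₁ e₂ (.round2 R) (.main (Main.init P R))
  | iterate (M : Main S) (d : Dir) (x : Node S) (hx : M.IsLeast d x)
      (hf : x.f d.pri ≤ M.fbar P d.pri) :
      Step P e₁ e₂ (.main M) (.main (M.iterate P d x))
  | stop_bound (M : Main S) (d : Dir) (x : Node S) (hx : M.IsLeast d x)
      (hf : M.fbar P d.pri < x.f d.pri) :
      Step P e₁ e₂ (.main M) (.returned M.toOutput)
  | stop_empty (M : Main S) (d : Dir) (ho : (M.search d).opn = 0) :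
      Step P e₁ e₂ (.main M) (.returned M.toOutput)

/-- A configuration that some run of the algorithm reaches. -/
def Reachable {S : Type*} [Fintype S] (P : Instance S) (e₁ e₂ : S → ℝ≥0) (c : Config S) : Prop :=
  Relation.ReflTransGen (Step P e₁ e₂) (initConfig P) c

/-- The returned solution pair holds exactly one node, and `π` is the start-goal sequence recovered
from it: the chain of parents of the node, joined with the complementary path of its state. -/
def Output.Represents {S : Type*} (out : Output S) (π : List S) : Prop :=
  (∃ x, out.sol = (some x, none) ∧
    π = (x.state :: x.anc).reverse ++ (out.comp .fwd x.state).tail) ∨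
  (∃ x, out.sol = (none, some x) ∧
    π = (out.comp .bwd x.state).reverse ++ x.anc)

end WCSPP

end

noncomputable section

namespace WCSPP

/-! ### Directions and lexicographic comparison -/

/-! Fix a lexicographically least cost `C` of a feasible path. It exists although there are
infinitely many walks: all path costs lie in the additive monoid generated by finitely many edge
costs, which is well-ordered. The property used throughout is `OptCost.eq_of_le`: a start-goal path
that is componentwise at most `C` costs exactly `C`. Hence one half of an optimal path can be
exchanged for a componentwise no dearer half only at equal cost.

Two invariants carry the constrained search. `Main.Sound`: every finite bound is the cost of an
actual path. The bounds of a state come in pairs, the primary pair `(h_p, ub_s)` and the secondary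
pair `(ub_p, h_s)`, each belonging to one complementary path. Tuning replaces only secondary pairs,
so on optimal paths the primary pairs keep the lexicographic minimality and the consistency they get
from round two (`Main.Exact`), and the stored `f_p` never goes stale.

`Main.Optimizing`: either `C` has been recorded, which is permanent, or the secondary lower bounds
are valid on optimal paths and both searches make `Main.Progress`: a covered part of an optimal path
has its next part open or covered. By consistency, before any uncovered part `a` ending in `u` there
is then an open node with `f_p` at most `a_p + h_p(u)` (`Progress.covered_or_open`). Three things
follow. The least node `x` at `u` satisfies `g_p(x) ≤ a_p`, so tuning by it is valid. If `x` newly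
covers `a`, then also `g_s(x) ≤ a_s`, and optimality forces `g(x) = a`; so dominance pruning loses
nothing. Finally, an unsolved search always has an open node within its bound, so neither search can
stop early. When an expansion ends with `h_p = ub_p`, or at the target, the primary join through `x`
is optimal and the early solution update has already recorded it.

Termination: an iteration either lowers some `g_min`, whose values lie in a well-ordered set, or
leaves all of them unchanged and shrinks a queue. -/

@[simp] theorem Dir.opp_opp (d : Dir) : d.opp.opp = d := by cases d <;> rfl
@[simp] theorem Dir.opp_pri (d : Dir) : d.opp.pri = d.sec := by cases d <;> rfl
@[simp] theorem Dir.opp_sec (d : Dir) : d.opp.sec = d.pri := by cases d <;> rfl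
@[simp] theorem Dir.opp_ne (d : Dir) : d.opp ≠ d := by cases d <;> simp [Dir.opp]
@[simp] theorem Dir.ne_opp (d : Dir) : d ≠ d.opp := by cases d <;> simp [Dir.opp]
@[simp] theorem Dir.pri_ne_sec (d : Dir) : d.pri ≠ d.sec := by cases d <;> simp [Dir.pri, Dir.sec]
@[simp] theorem Dir.sec_ne_pri (d : Dir) : d.sec ≠ d.pri := by cases d <;> simp [Dir.pri, Dir.sec]

theorem Dir.eq_pri_or_sec (d : Dir) (i : Fin 2) : i = d.pri ∨ i = d.sec := by
  cases d <;> fin_cases i <;> simp [Dir.pri, Dir.sec]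

theorem Dir.eq_or_opp (d d' : Dir) : d' = d ∨ d' = d.opp := by
  cases d <;> cases d' <;> simp [Dir.opp]

/-- Lexicographic comparison of cost vectors, attribute `p` first. -/
def LexLE (p : Fin 2) (a b : Fin 2 → ℝ≥0) : Prop :=
  a p < b p ∨ a p = b p ∧ a (other p) ≤ b (other p)

theorem LexLE.refl (p : Fin 2) (a : Fin 2 → ℝ≥0) : LexLE p a a := Or.inr ⟨rfl, le_rfl⟩

theorem LexLE.trans {p : Fin 2} {a b c : Fin 2 → ℝ≥0} (h : LexLE p a b) (h' : LexLE p b c) :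
    LexLE p a c := by
  rcases h with h | ⟨h, k⟩ <;> rcases h' with h' | ⟨h', k'⟩
  · exact Or.inl (h.trans h')
  · exact Or.inl (h' ▸ h)
  · exact Or.inl (h ▸ h')
  · exact Or.inr ⟨h.trans h', k.trans k'⟩

theorem LexLE.pri {p : Fin 2} {a b : Fin 2 → ℝ≥0} (h : LexLE p a b) : a p ≤ b p := by
  rcases h with h | ⟨h, -⟩
  exacts [h.le, h.le]

theorem LexLE.add_right {p : Fin 2} {a b : Fin 2 → ℝ≥0} (h : LexLE p a b) (c : Fin 2 → ℝ≥0) :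
    LexLE p (a + c) (b + c) := by
  rcases h with h | ⟨h, k⟩
  · exact Or.inl (by simpa using h)
  · exact Or.inr ⟨by simp [h], by simpa using k⟩

theorem lexLE_of_not_lt {p : Fin 2} {a b : Fin 2 → ℝ≥0}
    (h : ¬ toLex (a p, a (other p)) < toLex (b p, b (other p))) : LexLE p b a := by
  have := not_lt.1 h
  rwa [Prod.Lex.toLex_le_toLex] at this

theorem lexLE_of_lt {p : Fin 2} {a b : Fin 2 → ℝ≥0}
    (h : toLex (a p, a (other p)) < toLex (b p, b (other p))) : LexLE p a b := by
  have := h.le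
  rwa [Prod.Lex.toLex_le_toLex] at this

theorem toLex_le_toLex_of_le {α β : Type*} [PartialOrder α] [Preorder β] {a a' : α} {b b' : β}
    (h : a ≤ a') (h' : b ≤ b') : toLex (a, b) ≤ toLex (a', b') := by
  rw [Prod.Lex.toLex_le_toLex]
  rcases h.lt_or_eq with h | h
  exacts [Or.inl h, Or.inr ⟨h, h'⟩]

theorem fst_le_of_toLex_le {α β : Type*} [PartialOrder α] [Preorder β] {a a' : α} {b b' : β}
    (h : toLex (a, b) ≤ toLex (a', b')) : a ≤ a' := by
  rw [Prod.Lex.toLex_le_toLex] at h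
  rcases h with h | ⟨h, -⟩
  exacts [h.le, h.le]

/-! ### Trails -/

section Trails

variable {S : Type*} (P : Instance S)

@[simp] theorem Instance.arc_opp (d : Dir) (u v : S) : P.arc d.opp u v ↔ P.arc d v u := by
  cases d <;> rfl

@[simp] theorem Instance.arcCost_opp (d : Dir) (u v : S) :
    P.arcCost d.opp u v = P.arcCost d v u := by
  cases d <;> rfl

/-- `P.Trail d A u l c`: the list `l` leads from `u` back to the initial state of direction `d`
inside `A`, and the path obtained by reversing it has cost `c`. -/
inductive Instance.Trail (d : Dir) (A : Set S) : S → List S → (Fin 2 → ℝ≥0) → Prop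
  | root (h : P.initial d ∈ A) : Instance.Trail d A (P.initial d) [P.initial d] 0
  | step {u v : S} {l : List S} {c : Fin 2 → ℝ≥0} (t : Instance.Trail d A u l c)
      (h : P.arc d u v) (hv : v ∈ A) : Instance.Trail d A v (v :: l) (c + P.arcCost d u v)

/-- `u` is reached inside `A` by a path of cost `c`. -/
def Instance.Reach (d : Dir) (A : Set S) (u : S) (c : Fin 2 → ℝ≥0) : Prop :=
  ∃ l, P.Trail d A u l c

variable {P} {d : Dir} {A B : Set S} {u v : S} {l l' : List S} {a b c : Fin 2 → ℝ≥0}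

namespace Instance

theorem Trail.reach (t : P.Trail d A u l c) : P.Reach d A u c := ⟨l, t⟩

theorem Trail.mono (t : P.Trail d A u l c) (h : A ⊆ B) : P.Trail d B u l c := by
  induction t with
  | root h' => exact .root (h h')
  | step t ha hv ih => exact .step ih ha (h hv)

theorem Reach.mono (t : P.Reach d A u c) (h : A ⊆ B) : P.Reach d B u c :=
  let ⟨l, t⟩ := t; ⟨l, t.mono h⟩

theorem Reach.univ (t : P.Reach d A u c) : P.Reach d Set.univ u c := t.mono (Set.subset_univ A)

theorem Trail.mem (t : P.Trail d A u l c) : u ∈ A := by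
  cases t <;> assumption

theorem Reach.mem (t : P.Reach d A u c) : u ∈ A := let ⟨_, t⟩ := t; t.mem

theorem Reach.root (h : P.initial d ∈ A) : P.Reach d A (P.initial d) 0 := ⟨_, .root h⟩

theorem Reach.step (t : P.Reach d A u c) (h : P.arc d u v) (hv : v ∈ A) :
    P.Reach d A v (c + P.arcCost d u v) :=
  let ⟨_, t⟩ := t; ⟨_, t.step h hv⟩

/-- Prolong a backward trail by a forward arc. -/
theorem Reach.step_opp (t : P.Reach d.opp A v b) (h : P.arc d u v) (hu : u ∈ A) :
    P.Reach d.opp A u (b + P.arcCost d u v) := by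
  simpa using t.step ((P.arc_opp d v u).2 h) hu

theorem Trail.cons_tail (t : P.Trail d A u l c) : l = u :: l.tail := by
  cases t <;> rfl

/-- Induction moves the arcs of the forward trail, last one first, onto the backward trail; each of
them, reversed, is a backward step. When the forward trail is reduced to its root, the backward
trail starts at `start`. -/
theorem Trail.append (t : P.Trail .fwd Set.univ u l a) (t' : P.Trail .bwd Set.univ u l' b) :
    P.Trail .bwd Set.univ P.start (l.reverse ++ l'.tail) (a + b) := by
  induction t generalizing l' b with
  | root _ =>
    have := t'.cons_tail
    simp only [List.reverse_cons, List.reverse_nil, List.nil_append, zero_add,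
      List.singleton_append]
    rw [← this]
    exact t'
  | @step u v l c t ha hv ih =>
    have t'' := t'.step (v := u) (by exact ha) (Set.mem_univ _)
    have := ih t''
    rw [t'.cons_tail] at this
    have h : P.arcCost .bwd v u = P.arcCost .fwd u v := rfl
    simpa [h, add_assoc, add_comm, add_left_comm] using this

theorem Reach.join (t : P.Reach d Set.univ u a) (t' : P.Reach d.opp Set.univ u b) :
    P.Reach .bwd Set.univ P.start (a + b) := by
  obtain ⟨l, t⟩ := t
  obtain ⟨l', t'⟩ := t'
  cases d with
  | fwd => exact ⟨_, t.append t'⟩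
  | bwd => exact ⟨_, add_comm b a ▸ Trail.append t' t⟩

/-- A trail lists its states from the end point back to the root, so the list of a trail of the
opposite direction is already a path to the target, without reversal. -/
theorem Trail.isPath (t : P.Trail d.opp A u l c) :
    P.IsPath d u (P.target d) l ∧ P.pathCost d l = c := by
  induction t with
  | root _ => exact ⟨⟨rfl, rfl, List.isChain_singleton _⟩, rfl⟩
  | @step u v l c t ha hv ih =>
    obtain ⟨⟨h1, h2, h3⟩, h4⟩ := ih
    have hl := t.cons_tail
    rw [hl] at h1 h2 h3 h4 ⊢
    refine ⟨⟨rfl, by simpa using h2, ?_⟩, ?_⟩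
    · exact List.isChain_cons_cons.2 ⟨(P.arc_opp d u v).1 ha, h3⟩
    · rw [pathCost, h4, P.arcCost_opp d u v, add_comm]

theorem IsPath.trail (h : P.IsPath d u (P.target d) l) :
    P.Trail d.opp Set.univ u l (P.pathCost d l) := by
  induction l generalizing u with
  | nil => simp [IsPath] at h
  | cons x l ih =>
    obtain ⟨h1, h2, h3⟩ := h
    obtain rfl : x = u := by simpa using h1
    cases l with
    | nil =>
      obtain rfl : x = P.target d := by simpa using h2
      exact .root (Set.mem_univ _)
    | cons y l =>
      obtain ⟨h3, h4⟩ := List.isChain_cons_cons.1 h3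
      have := (ih ⟨rfl, by simpa using h2, h4⟩).step ((P.arc_opp d y x).2 h3) (Set.mem_univ _)
      rw [pathCost, add_comm]
      simpa using this

end Instance

end Trails

/-! ### Bounded A* -/

namespace HSearch

variable {S : Type*} {P : Instance S} {d : Dir} {p : Fin 2} {A : Set S} {e : S → ℝ≥0∞}
  {s : HSearch S} {u v : S} {l : Label S} {bound bound' : ℝ≥0∞}

variable (P d p A) in
/-- The invariant of a bounded A* in direction `d` on attribute `p` restricted to `A`. -/
structure Inv (s : HSearch S) : Prop where
  trail : ∀ u l, s.label u = some l → P.Trail d A u l.path l.cost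
  label_closed : ∀ u ∈ s.closed, ∃ l, s.label u = some l
  closed_least : ∀ u ∈ s.closed, ∀ l, s.label u = some l → ∀ c, P.Reach d A u c →
    LexLE p l.cost c
  succ : ∀ u ∈ s.closed, ∀ l, s.label u = some l → ∀ v ∈ A, P.arc d u v →
    ∃ m, s.label v = some m ∧ LexLE p m.cost (l.cost + P.arcCost d u v)
  root : P.initial d ∈ A → ∃ m, s.label (P.initial d) = some m ∧ LexLE p m.cost 0

variable (P d p A e) in
/-- A finished search has expanded all states whose estimate is within the bound. -/
def Complete (bound : ℝ≥0∞) (s : HSearch S) : Prop :=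
  s.finished → ∀ v c, P.Reach d A v c → (c p : ℝ≥0∞) + e v ≤ bound → v ∈ s.closed

variable (P d p A e) in
/-- The heuristic `e` is finite and consistent on `A`. -/
structure ConsistentOn : Prop where
  ne_top : ∀ u ∈ A, e u ≠ ⊤
  le_add : ∀ u ∈ A, ∀ v ∈ A, P.arc d u v → e u ≤ (P.arcCost d u v p : ℝ≥0∞) + e v

/-- The shared bound on `cost₁` may drop after a search has finished; completeness survives because
it was obtained for a larger bound. -/
theorem Complete.mono (h : Complete P d p A e bound s) (hb : bound' ≤ bound) :
    Complete P d p A e bound' s :=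
  fun hs v c hv hc => h hs v c hv (hc.trans hb)

theorem init_inv : Inv P d p A (init (P.initial d) A) where
  trail u l h := by
    simp only [init] at h
    split_ifs at h with h'
    obtain ⟨rfl, hu⟩ := h'
    cases h
    exact .root hu
  label_closed u hu := by simp [init] at hu
  closed_least u hu := by simp [init] at hu
  succ u hu := by simp [init] at hu
  root h := ⟨⟨0, [P.initial d]⟩, by simp [init, h], LexLE.refl _ _⟩

theorem key_le_key_of_lexLE {a b : Fin 2 → ℝ≥0} {x : ℝ≥0∞} (h : LexLE p a b) (hx : x ≠ ⊤) :
    toLex ((a p : ℝ≥0∞) + x, (a (other p) : ℝ≥0∞)) ≤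
      toLex ((b p : ℝ≥0∞) + x, (b (other p) : ℝ≥0∞)) := by
  rw [Prod.Lex.toLex_le_toLex]
  rcases h with h | ⟨h, k⟩
  · exact Or.inl (ENNReal.add_lt_add_right hx (by exact_mod_cast h))
  · exact Or.inr ⟨by simp [h], by simpa using k⟩

theorem lexLE_of_key_le_key {a b : Fin 2 → ℝ≥0} {x : ℝ≥0∞} (hx : x ≠ ⊤)
    (h : toLex ((a p : ℝ≥0∞) + x, (a (other p) : ℝ≥0∞)) ≤
      toLex ((b p : ℝ≥0∞) + x, (b (other p) : ℝ≥0∞))) : LexLE p a b := by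
  rw [Prod.Lex.toLex_le_toLex] at h
  rcases h with h | ⟨h, k⟩
  · exact Or.inl (by simpa using lt_of_add_lt_add_right h)
  · exact Or.inr ⟨by simpa using (ENNReal.add_left_inj hx).1 h, by simpa using k⟩

/-- Every path to an unexpanded state passes a state that waits for expansion. -/
theorem Inv.closed_or_open (h : Inv P d p A s) (he : ConsistentOn P d p A e) {c : Fin 2 → ℝ≥0}
    (hv : P.Reach d A v c) :
    v ∈ s.closed ∨ ∃ w m, s.IsOpen w m ∧
      key p e w m ≤ toLex ((c p : ℝ≥0∞) + e v, (c (other p) : ℝ≥0∞)) := by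
  obtain ⟨l, t⟩ := hv
  induction t with
  | root hA =>
    obtain ⟨m, hm, hc⟩ := h.root hA
    by_cases hr : P.initial d ∈ s.closed
    · exact Or.inl hr
    · exact Or.inr ⟨_, m, ⟨hm, hr⟩, key_le_key_of_lexLE hc (he.ne_top _ hA)⟩
  | @step u v l c t ha hv ih =>
    have hu := t.reach
    rcases ih with ih | ⟨w, m, hw, hk⟩
    · obtain ⟨l, hl⟩ := h.label_closed u ih
      -- The label of a closed state is minimal, so the label it induced at `v` is no worse than the
      -- given path.
      obtain ⟨m, hm, hc⟩ := h.succ u ih l hl v hv ha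
      by_cases hr : v ∈ s.closed
      · exact Or.inl hr
      · refine Or.inr ⟨_, m, ⟨hm, hr⟩, key_le_key_of_lexLE ?_ (he.ne_top _ hv)⟩
        exact hc.trans ((h.closed_least u ih l hl c hu).add_right _)
    · refine Or.inr ⟨w, m, hw, hk.trans (toLex_le_toLex_of_le ?_ ?_)⟩
      · calc (c p : ℝ≥0∞) + e u ≤ c p + (P.arcCost d u v p + e v) := by
              gcongr; exact he.le_add u hu.mem v hv ha
          _ = _ := by simp [add_assoc]
      · simp

/-- The classical A* argument: `u` is not closed, so some open state has a key bounded by that of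
the given path, and the key of `u` is smaller still. The finite term `e u` then cancels. -/
theorem Inv.least_of_isLeast (h : Inv P d p A s) (he : ConsistentOn P d p A e)
    (hl : s.IsLeast p e u l) {c : Fin 2 → ℝ≥0} (hc : P.Reach d A u c) : LexLE p l.cost c := by
  rcases h.closed_or_open he hc with hu | ⟨w, m, hw, hk⟩
  · exact absurd hu hl.1.2
  · exact lexLE_of_key_le_key (he.ne_top u hc.mem) ((hl.2 w m hw).trans hk)

theorem Inv.expand (h : Inv P d p A s) (he : ConsistentOn P d p A e)
    (hl : s.IsLeast p e u l) : Inv P d p A (s.expand P d p A u l) := by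
  -- Labels of closed states are frozen, and the other labels can only decrease.
  have hold : ∀ v ∈ insert u s.closed, (s.expand P d p A u l).label v = s.label v := by
    intro v hv
    simp only [HSearch.expand]
    rw [if_neg]
    exact fun h => h.2.2.1 hv
  have hle : ∀ v m, s.label v = some m →
      ∃ m', (s.expand P d p A u l).label v = some m' ∧ LexLE p m'.cost m.cost := by
    intro v m hm
    simp only [HSearch.expand]
    split_ifs with hc
    · exact ⟨_, rfl, lexLE_of_lt (hc.2.2.2 m hm)⟩
    · exact ⟨m, hm, LexLE.refl _ _⟩
  have hul := hl.1.1
  constructor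
  · intro v m hm
    simp only [HSearch.expand] at hm
    split_ifs at hm with hc
    · cases hm
      exact (h.trail u l hul).step hc.1 hc.2.1
    · exact h.trail v m hm
  · intro v hv
    rw [hold v hv]
    rcases hv with rfl | hv
    exacts [⟨l, hul⟩, h.label_closed v hv]
  · intro v hv m hm c hc
    rw [hold v hv] at hm
    rcases hv with rfl | hv
    · rw [hul] at hm
      cases hm
      exact h.least_of_isLeast he hl hc
    · exact h.closed_least v hv m hm c hc
  · intro v hv m hm w hw ha
    rw [hold v hv] at hm
    rcases hv with rfl | hv
    · rw [hul] at hm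
      cases hm
      by_cases hcl : w ∈ insert v s.closed
      · rw [hold w hcl]
        have hr : P.Reach d A w (l.cost + P.arcCost d v w) :=
          ((h.trail v l hul).step ha hw).reach
        rcases hcl with rfl | hcl
        · exact ⟨l, hul, h.least_of_isLeast he hl hr⟩
        · obtain ⟨m, hm⟩ := h.label_closed w hcl
          exact ⟨m, hm, h.closed_least w hcl m hm _ hr⟩
      · simp only [HSearch.expand]
        split_ifs with hc
        · exact ⟨_, rfl, LexLE.refl _ _⟩
        · have : ∃ old, s.label w = some old ∧ ¬ toLex ((l.cost + P.arcCost d v w) p,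
              (l.cost + P.arcCost d v w) (other p)) < toLex (old.cost p, old.cost (other p)) := by
            by_contra hn
            push Not at hn
            exact hc ⟨ha, hw, hcl, hn⟩
          obtain ⟨old, ho, hlt⟩ := this
          exact ⟨old, ho, lexLE_of_not_lt hlt⟩
    · obtain ⟨k, hk, hle'⟩ := h.succ v hv m hm w hw ha
      obtain ⟨k', hk', hle''⟩ := hle w k hk
      exact ⟨k', hk', hle''.trans hle'⟩
  · intro hr
    obtain ⟨k, hk, hle'⟩ := h.root hr
    obtain ⟨k', hk', hle''⟩ := hle _ k hk
    exact ⟨k', hk', hle''.trans hle'⟩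

theorem Inv.finish (h : Inv P d p A s) : Inv P d p A s.finish :=
  ⟨h.trail, h.label_closed, h.closed_least, h.succ, h.root⟩

theorem Complete.expand (hs : ¬ s.finished) (bound : ℝ≥0∞) :
    Complete P d p A e bound (s.expand P d p A u l) :=
  fun h => absurd h hs

/-- If such a state were not closed, an open state would have an estimate within the bound, and so
would the least one, which contradicts stopping. -/
theorem Inv.complete_finish (h : Inv P d p A s) (he : ConsistentOn P d p A e)
    (hf : s.CanFinish p e bound) : Complete P d p A e bound s.finish := by
  intro _ v c hv hc
  rcases h.closed_or_open he hv with hcl | ⟨w, m, hw, hk⟩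
  · exact hcl
  · rcases hf.2 with hn | ⟨u, l, hl, hb⟩
    · exact absurd hw (hn w m)
    · exact absurd hb (not_lt.2 ((fst_le_of_toLex_le ((hl.2 w m hw).trans hk)).trans hc))

/-- Outside the expanded states, the search has no value; there, it has the cost of its path. -/
theorem Inv.value_ne_top (h : Inv P d p A s) {i : Fin 2} (hu : s.value i u ≠ ⊤) :
    u ∈ s.closed ∧ ∃ l, s.label u = some l := by
  have hc : u ∈ s.closed := by
    by_contra hc
    simp [value, hc] at hu
  exact ⟨hc, h.label_closed u hc⟩

theorem value_of_closed (hu : u ∈ s.closed) (hl : s.label u = some l) (i : Fin 2) :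
    s.value i u = l.cost i := by
  simp [value, hu, hl]

theorem route_of_label (hl : s.label u = some l) : s.route u = l.path := by
  simp [route, hl]

/-- The values of an expanded state are the costs of a lexicographically smallest path. -/
theorem Inv.value_eq (h : Inv P d p A s) (hu : u ∈ s.closed) :
    ∃ a, P.Trail d A u (s.route u) a ∧ (∀ i, s.value i u = a i) ∧
      ∀ c, P.Reach d A u c → LexLE p a c := by
  obtain ⟨l, hl⟩ := h.label_closed u hu
  exact ⟨l.cost, route_of_label hl ▸ h.trail u l hl, value_of_closed hu hl,
    h.closed_least u hu l hl⟩

/-- The costs found by a search are a consistent heuristic for the opposite direction. -/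
theorem Inv.value_le_add (h : Inv P d.opp p A s) (hu : u ∈ s.closed) (hv : v ∈ s.closed)
    (huA : u ∈ A) (ha : P.arc d u v) :
    s.value p u ≤ (P.arcCost d u v p : ℝ≥0∞) + s.value p v := by
  obtain ⟨a, -, ha', hle⟩ := h.value_eq hu
  obtain ⟨b, hb, hb', -⟩ := h.value_eq hv
  rw [ha', hb']
  have := (hle _ (hb.reach.step_opp ha huA)).pri
  rw [add_comm]
  exact_mod_cast this

theorem Inv.consistentOn (h : Inv P d.opp p A s) {B : Set S} (hB : B ⊆ s.closed) (hBA : B ⊆ A) :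
    ConsistentOn P d p B (s.value p) where
  ne_top u hu := by
    obtain ⟨a, -, ha, -⟩ := h.value_eq (hB hu)
    rw [ha]
    exact ENNReal.coe_ne_top
  le_add u hu v hv := h.value_le_add (hB hu) (hB hv) (hBA hu)

end HSearch

/-! ### The optimal cost -/

section Optimum

variable {S : Type*} (P : Instance S)

/-- `c` is the cost of a start-goal path within the weight limit. -/
def FeasCost (c : Fin 2 → ℝ≥0) : Prop := P.Reach .bwd Set.univ P.start c ∧ c 1 ≤ P.W

/-- `C` is the lexicographically smallest cost of a start-goal path within the weight limit. -/
structure OptCost (C : Fin 2 → ℝ≥0) : Prop where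
  feas : FeasCost P C
  least : ∀ c, FeasCost P c → LexLE 0 C c

/-- `fbar` is infinite or attained by a feasible path. -/
def Attained (fbar : ℝ≥0∞) : Prop := fbar ≠ ⊤ → ∃ c, FeasCost P c ∧ fbar = c 0

/-- `u` lies on a start-goal path of cost `C`, after a part of cost `a` and before a part of
cost `b` in direction `d`. -/
structure Split (C : Fin 2 → ℝ≥0) (d : Dir) (u : S) (a b : Fin 2 → ℝ≥0) : Prop where
  left : P.Reach d Set.univ u a
  right : P.Reach d.opp Set.univ u b
  sum : a + b = C

variable {P} {C a b c : Fin 2 → ℝ≥0} {d : Dir} {u v : S} {x : ℝ≥0∞}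

/-- A lexicographic minimum is Pareto optimal. Feasibility of `c` is automatic, since `c 1 ≤ C 1 ≤
W`. -/
theorem OptCost.eq_of_le (hC : OptCost P C) (hc : P.Reach .bwd Set.univ P.start c)
    (h0 : c 0 ≤ C 0) (h1 : c 1 ≤ C 1) : c = C := by
  have := hC.least c ⟨hc, h1.trans hC.feas.2⟩
  have h01 : other 0 = 1 := rfl
  rcases this with h | ⟨h, k⟩
  · exact absurd h0 (not_le.2 h)
  · rw [h01] at k
    ext i
    fin_cases i
    · simp [h]
    · simp [le_antisymm h1 k]

theorem OptCost.le_of_attained (hC : OptCost P C) (hx : Attained P x) : (C 0 : ℝ≥0∞) ≤ x := by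
  by_cases h : x = ⊤
  · simp [h]
  · obtain ⟨c, hc, rfl⟩ := hx h
    exact_mod_cast (hC.least c hc).pri

theorem Split.symm (h : Split P C d u a b) : Split P C d.opp u b a :=
  ⟨h.right, by simpa using h.left, by rw [add_comm, h.sum]⟩

theorem Split.prev (h : Split P C d v (a + P.arcCost d u v) b) (hu : P.Reach d Set.univ u a)
    (ha : P.arc d u v) : Split P C d u a (b + P.arcCost d u v) :=
  ⟨hu, h.right.step_opp ha (Set.mem_univ _), by rw [← h.sum]; abel⟩

/-- A path to `u` that is not more expensive than an optimal one is equally expensive. -/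
theorem OptCost.eq_left (hC : OptCost P C) (h : Split P C d u a b)
    (hc : P.Reach d Set.univ u c) (hle : ∀ i, c i ≤ a i) : c = a := by
  have := hC.eq_of_le (hc.join h.right)
    (by rw [← h.sum]; exact add_le_add_left (hle 0) (b 0))
    (by rw [← h.sum]; exact add_le_add_left (hle 1) (b 1))
  rw [← h.sum] at this
  exact add_right_cancel this

theorem OptCost.eq_right (hC : OptCost P C) (h : Split P C d u a b)
    (hc : P.Reach d.opp Set.univ u c) (hle : ∀ i, c i ≤ b i) : c = b :=
  hC.eq_left h.symm hc hle

theorem OptCost.split_target (hC : OptCost P C) (d : Dir) : Split P C d (P.target d) C 0 := by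
  have : Split P C .bwd P.start C 0 :=
    ⟨hC.feas.1, .root (d := .fwd) (Set.mem_univ _), add_zero C⟩
  cases d with
  | bwd => exact this
  | fwd =>
    obtain ⟨l, t⟩ := hC.feas.1
    obtain ⟨⟨h1, h2, h3⟩, h4⟩ := t.isPath (d := .fwd)
    -- The backward trail is turned into a forward one arc by arc; `a` is the cost of the forward
    -- part built so far.
    have key : ∀ (l : List S) (u : S) (c : Fin 2 → ℝ≥0), P.Trail .bwd Set.univ u l c →
        ∀ a, P.Reach .fwd Set.univ u a → P.Reach .fwd Set.univ P.goal (a + c) := by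
      intro l u c t
      induction t with
      | root _ => intro a ha; rwa [add_zero]
      | @step u v l c t ha hv ih =>
        intro a hr
        have h' : P.arc .fwd v u := ha
        have := ih _ (hr.step h' (Set.mem_univ _))
        have hc : P.arcCost .bwd u v = P.arcCost .fwd v u := rfl
        rw [hc]
        rwa [add_assoc, add_comm _ c] at this
    have h0 := key _ _ _ t 0 (.root (d := .fwd) (Set.mem_univ _))
    rw [zero_add] at h0
    exact ⟨h0, .root (d := .bwd) (Set.mem_univ _), add_zero C⟩

theorem OptCost.split_initial (hC : OptCost P C) (d : Dir) : Split P C d (P.initial d) 0 C := by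
  have := (hC.split_target d.opp).symm
  simpa [Instance.target] using this

end Optimum

/-! ### Invariants of the constrained search -/

namespace Main

variable {S : Type*} {P : Instance S} {C : Fin 2 → ℝ≥0} {M : Main S} {d d' : Dir} {x : Node S}

variable (P) in
/-- A node carries the cost of its path and the right estimate on the primary attribute. -/
structure ValidNode (M : Main S) (d : Dir) (x : Node S) : Prop where
  trail : P.Trail d Set.univ x.state (x.state :: x.anc) x.g
  f_pri : x.f d.pri = x.g d.pri + M.h d d.pri x.state

/-- The costs of the complementary path of `u` that is best in the primary attribute. -/
def primary (M : Main S) (d : Dir) (u : S) (i : Fin 2) : ℝ≥0∞ :=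
  if i = d.pri then M.h d i u else M.ub d i u

/-- The costs of the complementary path of `u` that is best in the secondary attribute. -/
def secondary (M : Main S) (d : Dir) (u : S) (i : Fin 2) : ℝ≥0∞ :=
  if i = d.pri then M.ub d i u else M.h d i u

@[simp] theorem primary_pri (M : Main S) (d : Dir) (u : S) :
    M.primary d u d.pri = M.h d d.pri u := by simp [primary]
@[simp] theorem primary_sec (M : Main S) (d : Dir) (u : S) :
    M.primary d u d.sec = M.ub d d.sec u := by simp [primary]
@[simp] theorem secondary_pri (M : Main S) (d : Dir) (u : S) :
    M.secondary d u d.pri = M.ub d d.pri u := by simp [secondary]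
@[simp] theorem secondary_sec (M : Main S) (d : Dir) (u : S) :
    M.secondary d u d.sec = M.h d d.sec u := by simp [secondary]

variable (P) in
/-- All bounds, costs and solutions stem from paths. -/
structure Sound (M : Main S) : Prop where
  node : ∀ d, ∀ x ∈ (M.search d).opn, ValidNode P M d x
  gmin : ∀ d u, (M.search d).gmin u = ⊤ ∨
    ∃ a, P.Reach d Set.univ u a ∧ (M.search d).gmin u = a d.sec
  primary : ∀ d u i, M.primary d u i ≠ ⊤ →
    ∃ b, P.Trail d.opp Set.univ u (M.comp d u) b ∧ ∀ j, M.primary d u j = b j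
  secondary : ∀ d u i, M.secondary d u i ≠ ⊤ →
    ∃ b, P.Reach d.opp Set.univ u b ∧ ∀ j, M.secondary d u j = b j
  attained : Attained P M.fbar1
  sol : M.fsol2 ≠ ⊤ → ∃ π c, M.toOutput.Represents π ∧ P.Trail .bwd Set.univ P.start π c ∧
    M.fbar1 = c 0 ∧ M.fsol2 = c 1 ∧ c 1 ≤ P.W
  exists_feas : M.sol ≠ (none, none) → ∃ c, FeasCost P c

/-- The solution is optimal. -/
def Solved (C : Fin 2 → ℝ≥0) (M : Main S) : Prop := M.fbar1 = C 0 ∧ M.fsol2 = C 1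

/-- The solution pair holding the node `x` of direction `d`. -/
def solOf (d : Dir) (x : Node S) : Option (Node S) × Option (Node S) :=
  match d with
  | .fwd => (some x, none)
  | .bwd => (none, some x)

/-- The possible outcomes of the early solution update. -/
theorem esu_cases (hf : (x.g d.pri : ℝ≥0∞) + M.h d d.pri x.state ≤ M.fbar P d.pri) :
    (M.esu P d x = { M with
        fbar1 := x.g 0 + M.primary d x.state 0
        fsol2 := x.g 1 + M.primary d x.state 1
        sol := solOf d x } ∧
      (x.g 1 : ℝ≥0∞) + M.primary d x.state 1 ≤ P.W ∧
      (x.g 0 : ℝ≥0∞) + M.primary d x.state 0 ≤ M.fbar1 ∧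
      ((x.g 0 : ℝ≥0∞) + M.primary d x.state 0 < M.fbar1 ∨
        (x.g 1 : ℝ≥0∞) + M.primary d x.state 1 < M.fsol2)) ∨
    (M.esu P d x = { M with fbar1 := x.g 0 + M.secondary d x.state 0, fsol2 := ⊤ } ∧
      (x.g 1 : ℝ≥0∞) + M.secondary d x.state 1 ≤ P.W ∧
      (x.g 0 : ℝ≥0∞) + M.secondary d x.state 0 < M.fbar1 ∧
      ¬ ((x.g 1 : ℝ≥0∞) + M.primary d x.state 1 ≤ P.W ∧
        (x.g 0 : ℝ≥0∞) + M.primary d x.state 0 ≤ M.fbar1)) ∨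
    (M.esu P d x = M ∧
      ((x.g 1 : ℝ≥0∞) + M.primary d x.state 1 ≤ P.W →
        (x.g 0 : ℝ≥0∞) + M.primary d x.state 0 ≤ M.fbar1 →
        M.fbar1 ≤ x.g 0 + M.primary d x.state 0 ∧
          M.fsol2 ≤ x.g 1 + M.primary d x.state 1)) := by
  cases d with
  | fwd =>
    have h0 : M.primary .fwd x.state 0 = M.h .fwd 0 x.state := rfl
    have h1 : M.primary .fwd x.state 1 = M.ub .fwd 1 x.state := rfl
    have k0 : M.secondary .fwd x.state 0 = M.ub .fwd 0 x.state := rfl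
    have k1 : M.secondary .fwd x.state 1 = M.h .fwd 1 x.state := rfl
    replace hf : (x.g 0 : ℝ≥0∞) + M.h .fwd 0 x.state ≤ M.fbar1 := hf
    rw [h0, h1, k0, k1]
    simp only [esu]
    split_ifs with c1 c2 c3
    · exact Or.inl ⟨rfl, c1, hf, c2⟩
    · push Not at c2
      exact Or.inr (Or.inr ⟨rfl, fun _ _ => c2⟩)
    · exact Or.inr (Or.inl ⟨rfl, c3.1, c3.2, fun h => c1 h.1⟩)
    · exact Or.inr (Or.inr ⟨rfl, fun h => absurd h c1⟩)
  | bwd =>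
    have h0 : M.primary .bwd x.state 0 = M.ub .bwd 0 x.state := rfl
    have h1 : M.primary .bwd x.state 1 = M.h .bwd 1 x.state := rfl
    have k0 : M.secondary .bwd x.state 0 = M.h .bwd 0 x.state := rfl
    have k1 : M.secondary .bwd x.state 1 = M.ub .bwd 1 x.state := rfl
    replace hf : (x.g 1 : ℝ≥0∞) + M.h .bwd 1 x.state ≤ P.W := hf
    rw [h0, h1, k0, k1]
    simp only [esu]
    split_ifs with c1 c2 c3
    · exact Or.inl ⟨rfl, hf, c1, c2⟩
    · push Not at c2
      exact Or.inr (Or.inr ⟨rfl, fun _ _ => c2⟩)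
    · exact Or.inr (Or.inl ⟨rfl, c3.1, c3.2, fun h => c1 h.2⟩)
    · exact Or.inr (Or.inr ⟨rfl, fun _ h => absurd h c1⟩)

/-! ### Effect of the updates on the stored bounds -/

@[simp] theorem esu_h : (M.esu P d x).h = M.h := by
  unfold esu; cases d <;> dsimp only <;> split_ifs <;> rfl
@[simp] theorem esu_ub : (M.esu P d x).ub = M.ub := by
  unfold esu; cases d <;> dsimp only <;> split_ifs <;> rfl
@[simp] theorem esu_search : (M.esu P d x).search = M.search := by
  unfold esu; cases d <;> dsimp only <;> split_ifs <;> rfl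

@[simp] theorem tune_comp : (M.tune d x).comp = M.comp := by unfold tune; split_ifs <;> rfl
@[simp] theorem tune_search : (M.tune d x).search = M.search := by unfold tune; split_ifs <;> rfl
@[simp] theorem tune_fbar1 : (M.tune d x).fbar1 = M.fbar1 := by unfold tune; split_ifs <;> rfl
@[simp] theorem tune_fsol2 : (M.tune d x).fsol2 = M.fsol2 := by unfold tune; split_ifs <;> rfl
@[simp] theorem tune_sol : (M.tune d x).sol = M.sol := by unfold tune; split_ifs <;> rfl

/-- Tuning leaves the bounds for the primary attribute unchanged. -/
@[simp] theorem tune_h_pri : (M.tune d x).h d' d'.pri = M.h d' d'.pri := by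
  unfold tune
  split_ifs
  · funext v
    rcases d.eq_or_opp d' with rfl | rfl <;> simp
  · rfl

@[simp] theorem tune_ub_sec : (M.tune d x).ub d' d'.sec = M.ub d' d'.sec := by
  unfold tune
  split_ifs
  · funext v
    rcases d.eq_or_opp d' with rfl | rfl <;> simp
  · rfl

@[simp] theorem tune_primary : (M.tune d x).primary = M.primary := by
  funext d' u i
  rcases d'.eq_pri_or_sec i with rfl | rfl <;> simp

/-- Both entries of a secondary pair are overwritten together, so the pair still belongs to a single
path. The condition on `gmin` is kept because the validity of the new lower bound rests on it. -/
theorem tune_secondary (M : Main S) (d : Dir) (x : Node S) (d' : Dir) (u : S) :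
    (∀ i, (M.tune d x).secondary d' u i = M.secondary d' u i) ∨
    (d' = d.opp ∧ u = x.state ∧ (M.search d).gmin u = ⊤ ∧
      ∀ i, (M.tune d x).secondary d' u i = x.g i) := by
  unfold tune
  split_ifs with hg
  · by_cases h : d' = d.opp ∧ u = x.state
    · obtain ⟨rfl, rfl⟩ := h
      refine Or.inr ⟨rfl, rfl, hg, fun i => ?_⟩
      rcases d.eq_pri_or_sec i with rfl | rfl <;> simp [secondary]
    · refine Or.inl fun i => ?_
      have h1 : ∀ j, ¬ (d' = d.opp ∧ i = j ∧ u = x.state) := fun j hj => h ⟨hj.1, hj.2.2⟩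
      simp [secondary, h1]
  · exact Or.inl fun _ => rfl

/-! ### Preservation of soundness -/

theorem Sound.with_search (h : Sound P M) (s : Dir → Search S)
    (hn : ∀ d, ∀ x ∈ (s d).opn, ValidNode P M d x)
    (hg : ∀ d u, (s d).gmin u = ⊤ ∨ ∃ a, P.Reach d Set.univ u a ∧ (s d).gmin u = a d.sec) :
    Sound P { M with search := s } :=
  ⟨fun d x hx => ⟨(hn d x hx).trail, (hn d x hx).f_pri⟩, hg, h.primary, h.secondary, h.attained,
    h.sol, h.exists_feas⟩

theorem Sound.pop (h : Sound P M) (d : Dir) (x : Node S) : Sound P (M.pop d x) := by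
  classical
  refine h.with_search _ (fun d' y hy => ?_) (fun d' u => ?_)
  · dsimp only at hy
    split_ifs at hy with hd
    · subst hd
      exact h.node d' y (Multiset.mem_of_mem_erase hy)
    · exact h.node d' y hy
  · dsimp only
    split_ifs with hd
    · subst hd
      exact h.gmin d' u
    · exact h.gmin d' u

theorem Sound.setGmin (h : Sound P M) (hx : P.Reach d Set.univ x.state x.g) :
    Sound P (M.setGmin d x) := by
  refine h.with_search _ (fun d' y hy => ?_) (fun d' u => ?_)
  · dsimp only at hy
    split_ifs at hy with hd
    · subst hd
      exact h.node d' y hy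
    · exact h.node d' y hy
  · dsimp only
    split_ifs with hd
    · subst hd
      dsimp only
      split_ifs with hu
      · subst hu
        exact Or.inr ⟨_, hx, rfl⟩
      · exact h.gmin d' u
    · exact h.gmin d' u

theorem child_valid (hx : P.Trail d Set.univ x.state (x.state :: x.anc) x.g) {v : S}
    (hv : P.arc d x.state v) : ValidNode P M d (child P M d x v) :=
  ⟨hx.step hv (Set.mem_univ _), rfl⟩

theorem mem_exp [Fintype S] {y : Node S} : y ∈ ((M.exp P d x).search d).opn ↔
    y ∈ (M.search d).opn ∨ ∃ v, (P.arc d x.state v ∧ Keep P M d (child P M d x v)) ∧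
      child P M d x v = y := by
  simp [exp]

theorem exp_search_opp [Fintype S] : (M.exp P d x).search d.opp = M.search d.opp := by
  simp [exp]

theorem exp_gmin [Fintype S] : ((M.exp P d x).search d').gmin = (M.search d').gmin := by
  rcases d.eq_or_opp d' with rfl | rfl <;> simp [exp]

theorem Sound.exp [Fintype S] (h : Sound P M)
    (hx : P.Trail d Set.univ x.state (x.state :: x.anc) x.g) : Sound P (M.exp P d x) := by
  refine h.with_search _ (fun d' y hy => ?_) (fun d' u => ?_)
  · change y ∈ ((M.exp P d x).search d').opn at hy
    rcases d.eq_or_opp d' with rfl | rfl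
    · rcases mem_exp.1 hy with hy | ⟨v, hv, rfl⟩
      · exact h.node _ y hy
      · exact child_valid hx hv.1
    · rw [exp_search_opp] at hy
      exact h.node _ y hy
  · change ((M.exp P d x).search d').gmin u = ⊤ ∨
      ∃ a, _ ∧ ((M.exp P d x).search d').gmin u = _
    rw [exp_gmin]
    exact h.gmin d' u

theorem Sound.tune (h : Sound P M) (hx : P.Reach d Set.univ x.state x.g) :
    Sound P (M.tune d x) := by
  constructor
  · intro d' y hy
    rw [tune_search] at hy
    exact ⟨(h.node d' y hy).trail, by simpa using (h.node d' y hy).f_pri⟩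
  · simpa using h.gmin
  · simpa using h.primary
  · intro d' u i hi
    rcases tune_secondary M d x d' u with hs | ⟨rfl, rfl, -, hs⟩
    · simp only [hs] at hi ⊢
      exact h.secondary d' u i hi
    · exact ⟨x.g, by simpa using hx, hs⟩
  · simpa using h.attained
  · simpa [toOutput] using h.sol
  · simpa using h.exists_feas

/-- Each join used by the update combines the path of `x` with the one path behind a primary or a
secondary pair, so its two costs are the costs of one start-goal path. In the second outcome `fsol2`
becomes infinite, and nothing has to be claimed about the outdated solution except that a feasible
path exists. -/
theorem Sound.esu (h : Sound P M) (hx : P.Trail d Set.univ x.state (x.state :: x.anc) x.g)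
    (hf : (x.g d.pri : ℝ≥0∞) + M.h d d.pri x.state ≤ M.fbar P d.pri) :
    Sound P (M.esu P d x) := by
  rcases esu_cases hf with ⟨he, hW, -, -⟩ | ⟨he, hW, hlt, -⟩ | ⟨he, -⟩
  · rw [he]
    have hne : M.primary d x.state 1 ≠ ⊤ :=
      fun h => by simp [h] at hW
    obtain ⟨b, hb, hj⟩ := h.primary _ _ _ hne
    have h0 : (x.g 0 : ℝ≥0∞) + M.primary d x.state 0 = ((x.g + b) 0 : ℝ≥0) := by simp [hj]
    have h1 : (x.g 1 : ℝ≥0∞) + M.primary d x.state 1 = ((x.g + b) 1 : ℝ≥0) := by simp [hj]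
    have hW' : (x.g + b) 1 ≤ P.W := by rw [h1] at hW; exact_mod_cast hW
    have hfeas : FeasCost P (x.g + b) := ⟨hx.reach.join hb.reach, hW'⟩
    refine ⟨fun d y hy => ⟨(h.node d y hy).trail, (h.node d y hy).f_pri⟩, h.gmin, h.primary,
      h.secondary, fun _ => ⟨_, hfeas, h0⟩, fun _ => ?_, fun _ => ⟨_, hfeas⟩⟩
    cases d with
    | fwd => exact ⟨_, x.g + b, Or.inl ⟨x, rfl, rfl⟩, hx.append hb, h0, h1, hW'⟩
    | bwd =>
      exact ⟨_, x.g + b, Or.inr ⟨x, rfl, rfl⟩, add_comm b x.g ▸ Instance.Trail.append hb hx,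
        h0, h1, hW'⟩
  · rw [he]
    have hne : M.secondary d x.state 1 ≠ ⊤ :=
      fun h => by simp [h] at hW
    obtain ⟨b, hb, hj⟩ := h.secondary _ _ _ hne
    have h0 : (x.g 0 : ℝ≥0∞) + M.secondary d x.state 0 = ((x.g + b) 0 : ℝ≥0) := by simp [hj]
    have h1 : (x.g 1 : ℝ≥0∞) + M.secondary d x.state 1 = ((x.g + b) 1 : ℝ≥0) := by simp [hj]
    have hW' : (x.g + b) 1 ≤ P.W := by rw [h1] at hW; exact_mod_cast hW
    have hfeas : FeasCost P (x.g + b) := ⟨hx.reach.join hb, hW'⟩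
    exact ⟨fun d y hy => ⟨(h.node d y hy).trail, (h.node d y hy).f_pri⟩, h.gmin, h.primary,
      h.secondary, fun _ => ⟨_, hfeas, h0⟩, fun hn => absurd rfl hn, h.exists_feas⟩
  · rwa [he]

/-- A solution of optimal cost is never replaced. -/
theorem Solved.esu (hs : Solved C M) (hC : OptCost P C) (h : Sound P M)
    (hx : P.Reach d Set.univ x.state x.g)
    (hf : (x.g d.pri : ℝ≥0∞) + M.h d d.pri x.state ≤ M.fbar P d.pri) :
    Solved C (M.esu P d x) := by
  rcases esu_cases hf with ⟨he, hW, hle, hlt⟩ | ⟨he, hW, hlt, -⟩ | ⟨he, -⟩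
  · have hne : M.primary d x.state 1 ≠ ⊤ :=
      fun h => by simp [h] at hW
    obtain ⟨b, hb, hj⟩ := h.primary _ _ _ hne
    have h0 : (x.g 0 : ℝ≥0∞) + M.primary d x.state 0 = ((x.g + b) 0 : ℝ≥0) := by simp [hj]
    have h1 : (x.g 1 : ℝ≥0∞) + M.primary d x.state 1 = ((x.g + b) 1 : ℝ≥0) := by simp [hj]
    rw [h0, h1, hs.1, hs.2] at hlt
    rw [h0, hs.1] at hle
    rw [h1] at hW
    norm_cast at hlt hle hW
    have := hC.least _ ⟨hx.join hb.reach, hW⟩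
    rcases this with h | ⟨h, k⟩
    · exact absurd hle (not_le.2 h)
    · rcases hlt with hlt | hlt
      · exact absurd h hlt.ne'
      · exact absurd k (not_le.2 hlt)
  · have hne : M.secondary d x.state 1 ≠ ⊤ :=
      fun h => by simp [h] at hW
    obtain ⟨b, hb, hj⟩ := h.secondary _ _ _ hne
    have h0 : (x.g 0 : ℝ≥0∞) + M.secondary d x.state 0 = ((x.g + b) 0 : ℝ≥0) := by simp [hj]
    have h1 : (x.g 1 : ℝ≥0∞) + M.secondary d x.state 1 = ((x.g + b) 1 : ℝ≥0) := by simp [hj]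
    rw [h0, hs.1] at hlt
    rw [h1] at hW
    norm_cast at hlt hW
    exact absurd (hC.least _ ⟨hx.join hb, hW⟩).pri (not_le.2 hlt)
  · rwa [he]

/-- The solution is optimal after the update if the join with the primary path is. -/
theorem solved_esu (hC : OptCost P C) (h : Sound P M) (hx : P.Reach d Set.univ x.state x.g)
    (hf : (x.g d.pri : ℝ≥0∞) + M.h d d.pri x.state ≤ M.fbar P d.pri)
    (hle : ∀ i, (x.g i : ℝ≥0∞) + M.primary d x.state i ≤ C i) : Solved C (M.esu P d x) := by
  have hne : M.primary d x.state 1 ≠ ⊤ := fun h => by simpa [h] using hle 1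
  obtain ⟨b, hb, hj⟩ := h.primary _ _ _ hne
  have hsum : ∀ i, (x.g i : ℝ≥0∞) + M.primary d x.state i = ((x.g + b) i : ℝ≥0) := by simp [hj]
  simp only [hsum, ENNReal.coe_le_coe] at hle
  have hCb := hC.eq_of_le (hx.join hb.reach) (hle 0) (hle 1)
  rw [hCb] at hsum
  have hW : (x.g 1 : ℝ≥0∞) + M.primary d x.state 1 ≤ P.W := by
    rw [hsum]; exact_mod_cast hC.feas.2
  have hb0 : (x.g 0 : ℝ≥0∞) + M.primary d x.state 0 ≤ M.fbar1 := by
    rw [hsum]; exact hC.le_of_attained h.attained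
  rcases esu_cases hf with ⟨he, -⟩ | ⟨-, -, -, hn⟩ | ⟨he, hle'⟩
  · rw [he]
    exact ⟨hsum 0, hsum 1⟩
  · exact absurd ⟨hW, hb0⟩ hn
  · rw [he]
    obtain ⟨k0, k1⟩ := hle' hW hb0
    rw [hsum] at k0 k1
    have h0 : M.fbar1 = C 0 := le_antisymm k0 (hC.le_of_attained h.attained)
    -- The update was skipped, so the recorded pair is already no larger than `C`; being the cost of
    -- a path, it equals `C`.
    obtain ⟨π, c, -, ht, hc0, hc1, -⟩ := h.sol (ne_top_of_le_ne_top ENNReal.coe_ne_top k1)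
    rw [hc1] at k1
    have : c = C := hC.eq_of_le ht.reach (by rw [h0] at hc0; exact_mod_cast hc0.ge)
      (by exact_mod_cast k1)
    exact ⟨h0, by rw [hc1, this]⟩

/-- A part of cost `a` of an optimal path waits for expansion in `u`. -/
def Opened (C : Fin 2 → ℝ≥0) (d : Dir) (s : Search S) (u : S) (a : Fin 2 → ℝ≥0) : Prop :=
  ∃ y ∈ s.opn, y.state = u ∧ y.g = a ∧ y.f d.sec ≤ C d.sec

/-- A part of cost `a` of an optimal path has been expanded in `u`, or is weakly dominated. -/
def Covered (d : Dir) (s : Search S) (u : S) (a : Fin 2 → ℝ≥0) : Prop := s.gmin u ≤ a d.sec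

variable (P C d) in
/-- Every part of an optimal path is continued, unless it waits for expansion. -/
structure Progress (s : Search S) : Prop where
  root : Opened C d s (P.initial d) 0 ∨ Covered d s (P.initial d) 0
  step : ∀ u v a b, P.Reach d Set.univ u a → P.arc d u v →
    Split P C d v (a + P.arcCost d u v) b → Covered d s u a →
    Opened C d s v (a + P.arcCost d u v) ∨ Covered d s v (a + P.arcCost d u v)
  target : ¬ Covered d s (P.target d) C

variable (P C) in
/-- On optimal paths, the primary bounds are lexicographic minima and consistent. -/
structure Exact (M : Main S) : Prop where
  le : ∀ d u a b, Split P C d u a b → M.h d d.pri u ≤ b d.pri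
  ub_le : ∀ d u a b, Split P C d u a b → M.h d d.pri u = b d.pri → M.ub d d.sec u ≤ b d.sec
  consistent : ∀ d u v a b a' b', Split P C d u a b → Split P C d v a' b' → P.arc d u v →
    M.h d d.pri u ≤ (P.arcCost d u v d.pri : ℝ≥0∞) + M.h d d.pri v

variable (P C) in
/-- On optimal paths, the secondary lower bounds are valid. -/
def Valid (M : Main S) : Prop := ∀ d u a b, Split P C d u a b → M.h d d.sec u ≤ b d.sec

variable (P C) in
/-- The invariant that yields optimality. -/
structure Optimizing (M : Main S) : Prop where
  exact : Exact P C M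
  live : Solved C M ∨ (Valid P C M ∧ ∀ d, Progress P C d (M.search d))

/-! ### Progress along optimal paths -/

theorem Exact.congr {M' : Main S} (h : Exact P C M) (hh : ∀ d, M'.h d d.pri = M.h d d.pri)
    (hu : ∀ d, M'.ub d d.sec = M.ub d d.sec) : Exact P C M' := by
  constructor
  · simpa only [hh] using h.le
  · simpa only [hh, hu] using h.ub_le
  · simpa only [hh] using h.consistent

/-- A part of an optimal path is covered, or an open node precedes it. -/
theorem Progress.covered_or_open (hp : Progress P C d (M.search d)) (h : Sound P M)
    (he : Exact P C M) {u : S} {a b : Fin 2 → ℝ≥0} (hs : Split P C d u a b) :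
    Covered d (M.search d) u a ∨ ∃ y ∈ (M.search d).opn,
      y.f d.pri ≤ (a d.pri : ℝ≥0∞) + M.h d d.pri u ∧ y.f d.sec ≤ C d.sec := by
  have hopen : ∀ v c, Opened C d (M.search d) v c → ∃ y ∈ (M.search d).opn,
      y.f d.pri ≤ (c d.pri : ℝ≥0∞) + M.h d d.pri v ∧ y.f d.sec ≤ C d.sec := by
    rintro v c ⟨y, hy, rfl, rfl, hf⟩
    exact ⟨y, hy, (h.node d y hy).f_pri.le, hf⟩
  obtain ⟨l, t⟩ := hs.left
  induction t generalizing b with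
  | root _ => exact hp.root.symm.imp_right (hopen _ _)
  | @step u v l c t ha hv ih =>
    have hprev := hs.prev t.reach ha
    rcases ih hprev with hc | ⟨y, hy, hf, hf'⟩
    · exact (hp.step u v c b t.reach ha hs hc).symm.imp_right (hopen _ _)
    · refine Or.inr ⟨y, hy, hf.trans ?_, hf'⟩
      calc (c d.pri : ℝ≥0∞) + M.h d d.pri u
          ≤ c d.pri + (P.arcCost d u v d.pri + M.h d d.pri v) := by
            gcongr; exact he.consistent d u v _ _ _ _ hprev hs ha
        _ = _ := by simp [add_assoc]

/-- An unsolved search has an open node within the bounds. -/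
theorem Progress.exists_open (hp : Progress P C d (M.search d)) (h : Sound P M)
    (he : Exact P C M) (hC : OptCost P C) :
    ∃ y ∈ (M.search d).opn, y.f d.pri ≤ M.fbar P d.pri := by
  have hs := hC.split_target d
  rcases hp.covered_or_open h he hs with hc | ⟨y, hy, hf, -⟩
  · exact absurd hc hp.target
  · refine ⟨y, hy, hf.trans ?_⟩
    have h0 := he.le d _ _ _ hs
    have : M.h d d.pri (P.target d) = 0 := by simpa using h0
    rw [this, add_zero]
    cases d with
    | fwd => exact hC.le_of_attained h.attained
    | bwd => exact ENNReal.coe_le_coe.2 hC.feas.2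

/-- A least node of a state whose part of an optimal path is not covered yet does not exceed that
part in the primary attribute. -/
theorem Progress.g_pri_le (hp : Progress P C d (M.search d)) (h : Sound P M)
    (he : Exact P C M) (hx : M.IsLeast d x) {a b : Fin 2 → ℝ≥0} (hs : Split P C d x.state a b)
    (hc : ¬ Covered d (M.search d) x.state a) : x.g d.pri ≤ a d.pri := by
  rcases hp.covered_or_open h he hs with hc' | ⟨y, hy, hf, -⟩
  · exact absurd hc' hc
  · have hle := (fst_le_of_toLex_le (hx.2 y hy)).trans hf
    rw [(h.node d x hx.1).f_pri] at hle
    have hne : M.h d d.pri x.state ≠ ⊤ :=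
      ne_top_of_le_ne_top ENNReal.coe_ne_top (he.le d _ _ _ hs)
    exact_mod_cast (ENNReal.add_le_add_iff_right hne).1 hle

/-- Covered parts stay covered because `gmin` never increases. Hence only open nodes that leave the
queue and parts that become newly covered need attention. -/
theorem Progress.update {s s' : Search S} (hp : Progress P C d s)
    (hg : ∀ u, s'.gmin u ≤ s.gmin u)
    (ho : ∀ y ∈ s.opn, y.f d.sec ≤ C d.sec → y ∈ s'.opn ∨ Covered d s' y.state y.g)
    (hnew : ∀ u a b, Split P C d u a b → Covered d s' u a → ¬ Covered d s u a →
      u ≠ P.target d ∨ a ≠ C)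
    (hstep : ∀ u v a b, P.Reach d Set.univ u a → P.arc d u v →
      Split P C d v (a + P.arcCost d u v) b → Covered d s' u a → ¬ Covered d s u a →
      Opened C d s' v (a + P.arcCost d u v) ∨ Covered d s' v (a + P.arcCost d u v))
    (hC : OptCost P C) : Progress P C d s' := by
  have hcov : ∀ u a, Covered d s u a → Covered d s' u a := fun u a h => (hg u).trans h
  have hopen : ∀ u a, Opened C d s u a → Opened C d s' u a ∨ Covered d s' u a := by
    rintro u a ⟨y, hy, rfl, rfl, hf⟩
    exact (ho y hy hf).imp_left fun h => ⟨y, h, rfl, rfl, hf⟩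
  have hor : ∀ u a, Opened C d s u a ∨ Covered d s u a → Opened C d s' u a ∨ Covered d s' u a := by
    rintro u a (h | h)
    exacts [hopen u a h, Or.inr (hcov u a h)]
  refine ⟨hor _ _ hp.root, fun u v a b hu ha hs hc => ?_, fun hc => ?_⟩
  · by_cases hc' : Covered d s u a
    · exact hor _ _ (hp.step u v a b hu ha hs hc')
    · exact hstep u v a b hu ha hs hc hc'
  · have := hnew _ _ _ (hC.split_target d) hc hp.target
    simp at this

/-! ### Discarding a node and updating the bounds -/

theorem pop_search : (M.pop d x).search d.opp = M.search d.opp := by simp [pop]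

theorem pop_gmin : ((M.pop d x).search d').gmin = (M.search d').gmin := by
  rcases d.eq_or_opp d' with rfl | rfl <;> simp [pop]

theorem mem_pop {y : Node S} (hy : y ∈ (M.search d).opn) :
    y = x ∨ y ∈ ((M.pop d x).search d).opn := by
  classical
  by_cases h : y = x
  · exact Or.inl h
  · refine Or.inr ?_
    simp only [pop, if_true]
    exact (Multiset.mem_erase_of_ne h).2 hy

/-- Discarding `x` is harmless if its part is already covered, or if its stored `f_s` exceeds `C`:
such a node does not count as `Opened`. The two pruning tests before an exploration correspond to
these two cases. -/
theorem Optimizing.pop (h : Optimizing P C M) (hC : OptCost P C)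
    (hx : x.f d.sec ≤ C d.sec → Covered d (M.search d) x.state x.g) :
    Optimizing P C (M.pop d x) := by
  refine ⟨h.exact.congr (fun _ => rfl) (fun _ => rfl), h.live.imp id fun ⟨hv, hp⟩ => ⟨hv, ?_⟩⟩
  intro d'
  rcases d.eq_or_opp d' with rfl | rfl
  · have hg : ((M.pop d' x).search d').gmin = (M.search d').gmin := pop_gmin
    refine (hp d').update (fun u => by rw [hg]) (fun y hy hf => ?_) ?_ ?_ hC
    · rcases mem_pop (x := x) hy with rfl | hy
      · exact Or.inr (by unfold Covered; rw [hg]; exact hx hf)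
      · exact Or.inl hy
    · intro u a b _ hc hc'
      unfold Covered at hc hc'
      rw [hg] at hc
      exact absurd hc hc'
    · intro u v a b _ _ _ hc hc'
      unfold Covered at hc hc'
      rw [hg] at hc
      exact absurd hc hc'
  · rw [pop_search]
    exact hp _

/-- The configuration after the bounds have been updated in the exploration of a node. -/
def settle (P : Instance S) (M : Main S) (d : Dir) (x : Node S) : Main S :=
  (((M.pop d x).tune d x).setGmin d x).esu P d x

theorem settle_h : (M.settle P d x).h = ((M.pop d x).tune d x).h := esu_h
theorem settle_ub : (M.settle P d x).ub = ((M.pop d x).tune d x).ub := esu_ub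

theorem settle_h_pri : (M.settle P d x).h d' d'.pri = M.h d' d'.pri := by
  rw [settle_h, tune_h_pri]; rfl
theorem settle_ub_sec : (M.settle P d x).ub d' d'.sec = M.ub d' d'.sec := by
  rw [settle_ub, tune_ub_sec]; rfl

theorem settle_search_opp : (M.settle P d x).search d.opp = M.search d.opp := by
  rw [settle, esu_search]
  simp [setGmin, pop]

theorem settle_opn : ((M.settle P d x).search d).opn = ((M.pop d x).search d).opn := by
  rw [settle, esu_search]
  simp [setGmin]

open scoped Classical in
theorem settle_gmin (v : S) : ((M.settle P d x).search d).gmin v =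
    if v = x.state then (x.g d.sec : ℝ≥0∞) else (M.search d).gmin v := by
  rw [settle, esu_search]
  simp [setGmin, pop]

theorem settle_bound (hf : (x.g d.pri : ℝ≥0∞) + M.h d d.pri x.state ≤ M.fbar P d.pri) :
    (x.g d.pri : ℝ≥0∞) + (((M.pop d x).tune d x).setGmin d x).h d d.pri x.state ≤
      (((M.pop d x).tune d x).setGmin d x).fbar P d.pri := by
  have h1 : (((M.pop d x).tune d x).setGmin d x).h d d.pri = M.h d d.pri := by
    change ((M.pop d x).tune d x).h d d.pri = _
    rw [tune_h_pri]; rfl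
  have h2 : (((M.pop d x).tune d x).setGmin d x).fbar1 = M.fbar1 := by
    change ((M.pop d x).tune d x).fbar1 = _
    rw [tune_fbar1]; rfl
  rw [h1]
  simpa only [fbar, h2] using hf

theorem Sound.settle (h : Sound P M) (hx : P.Trail d Set.univ x.state (x.state :: x.anc) x.g)
    (hf : (x.g d.pri : ℝ≥0∞) + M.h d d.pri x.state ≤ M.fbar P d.pri) :
    Sound P (M.settle P d x) :=
  (((h.pop d x).tune hx.reach).setGmin hx.reach).esu hx (settle_bound hf)

theorem Solved.settle (hs : Solved C M) (hC : OptCost P C) (h : Sound P M)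
    (hx : P.Trail d Set.univ x.state (x.state :: x.anc) x.g)
    (hf : (x.g d.pri : ℝ≥0∞) + M.h d d.pri x.state ≤ M.fbar P d.pri) :
    Solved C (M.settle P d x) := by
  have h1 : Solved C (((M.pop d x).tune d x).setGmin d x) := by
    change ((M.pop d x).tune d x).fbar1 = _ ∧ ((M.pop d x).tune d x).fsol2 = _
    rw [tune_fbar1, tune_fsol2]
    exact hs
  exact h1.esu hC (((h.pop d x).tune hx.reach).setGmin hx.reach) hx.reach (settle_bound hf)

/-- If the path through `x` and the primary path is optimal, the problem is solved. -/
theorem solved_settle (hC : OptCost P C) (h : Sound P M)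
    (hx : P.Trail d Set.univ x.state (x.state :: x.anc) x.g)
    (hf : (x.g d.pri : ℝ≥0∞) + M.h d d.pri x.state ≤ M.fbar P d.pri)
    (hle : ∀ i, (x.g i : ℝ≥0∞) + M.primary d x.state i ≤ C i) :
    Solved C (M.settle P d x) := by
  refine solved_esu hC (((h.pop d x).tune hx.reach).setGmin hx.reach) hx.reach
    (settle_bound hf) ?_
  change ∀ i, (x.g i : ℝ≥0∞) + ((M.pop d x).tune d x).primary d x.state i ≤ C i
  rw [tune_primary]
  exact hle

/-- Tuning happens at the first expansion of a state, when `gmin` is infinite and no part ending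
there is covered. The least node then has `g_p` at most that of every optimal part, which is
validity of the new bound in the opposite direction. -/
theorem Valid.settle (hv : Valid P C M) (hp : Progress P C d (M.search d)) (h : Sound P M)
    (he : Exact P C M) (hx : M.IsLeast d x) : Valid P C (M.settle P d x) := by
  intro d' u a b hs
  rw [settle_h]
  have := tune_secondary (M.pop d x) d x d' u
  rcases this with ht | ⟨rfl, rfl, hg, ht⟩
  · have := ht d'.sec
    rw [secondary_sec, secondary_sec] at this
    rw [this]
    exact hv d' u a b hs
  · have := ht d.opp.sec
    rw [secondary_sec] at this
    rw [this]
    rw [pop_gmin] at hg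
    simp only [Dir.opp_sec]
    have hs' : Split P C d x.state b a := by simpa using hs.symm
    refine ENNReal.coe_le_coe.2 (hp.g_pri_le h he hx hs' ?_)
    simp [Covered, hg]

theorem Valid.exact_lower (hv : Valid P C M) (he : Exact P C M) {u : S} {a b : Fin 2 → ℝ≥0}
    (hs : Split P C d u a b) (i : Fin 2) : M.h d i u ≤ b i := by
  rcases d.eq_pri_or_sec i with rfl | rfl
  exacts [he.le d u a b hs, hv d u a b hs]

/-- Parts of optimal paths respect the upper bounds of their states. -/
theorem Valid.le_ub (hv : Valid P C M) (he : Exact P C M) (h : Sound P M) (hC : OptCost P C)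
    {u : S} {a b : Fin 2 → ℝ≥0} (hs : Split P C d u a b) (i : Fin 2) :
    (b i : ℝ≥0∞) ≤ M.ub d i u := by
  by_contra hlt
  rw [not_le] at hlt
  -- A smaller upper bound would belong to a path whose other cost is a valid lower bound. That path
  -- would be at most `b` in both attributes, so optimality would force equality.
  rcases d.eq_pri_or_sec i with rfl | rfl
  · have hne : M.secondary d u d.pri ≠ ⊤ := by simpa using hlt.ne_top
    obtain ⟨c, hc, hj⟩ := h.secondary _ _ _ hne
    have h1 := hj d.pri
    have h2 := hj d.sec
    rw [secondary_pri] at h1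
    rw [secondary_sec] at h2
    have h3 := hv d u a b hs
    rw [h1] at hlt
    rw [h2] at h3
    norm_cast at hlt h3
    have := hC.eq_right hs hc fun i => by
      rcases d.eq_pri_or_sec i with rfl | rfl
      exacts [hlt.le, h3]
    exact hlt.ne (by rw [this])
  · have hne : M.primary d u d.sec ≠ ⊤ := by simpa using hlt.ne_top
    obtain ⟨c, hc, hj⟩ := h.primary _ _ _ hne
    have h1 := hj d.pri
    have h2 := hj d.sec
    rw [primary_pri] at h1
    rw [primary_sec] at h2
    have h3 := he.le d u a b hs
    rw [h2] at hlt
    rw [h1] at h3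
    norm_cast at hlt h3
    have := hC.eq_right hs hc.reach fun i => by
      rcases d.eq_pri_or_sec i with rfl | rfl
      exacts [h3, hlt.le]
    exact hlt.ne (by rw [this])

/-- If the primary and the secondary path of a state of an optimal path agree in the primary
attribute, the primary path completes an optimal path. -/
theorem Valid.primary_le (hv : Valid P C M) (he : Exact P C M) (h : Sound P M) (hC : OptCost P C)
    {u : S} {a b : Fin 2 → ℝ≥0} (hs : Split P C d u a b) (heq : M.h d d.pri u = M.ub d d.pri u)
    (i : Fin 2) : M.primary d u i ≤ b i := by
  have h3 := he.le d u a b hs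
  have hne : M.secondary d u d.pri ≠ ⊤ := by
    rw [secondary_pri, ← heq]
    exact ne_top_of_le_ne_top ENNReal.coe_ne_top h3
  obtain ⟨c, hc, hj⟩ := h.secondary _ _ _ hne
  have h1 := hj d.pri
  have h2 := hj d.sec
  rw [secondary_pri, ← heq] at h1
  rw [secondary_sec] at h2
  have h4 := hv d u a b hs
  rw [h2] at h4
  rw [h1] at h3
  norm_cast at h3 h4
  -- The secondary path is at most `b` in both attributes, so it costs exactly `b`. Thus `h_p =
  -- b_p`, and lexicographic minimality of the primary pair bounds its second entry.
  have := hC.eq_right hs hc fun i => by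
    rcases d.eq_pri_or_sec i with rfl | rfl
    exacts [h3, h4]
  subst this
  rcases d.eq_pri_or_sec i with rfl | rfl
  · rw [primary_pri]
    exact h1.le
  · rw [primary_sec]
    exact he.ub_le d u a c hs h1

/-! ### Exploration of a node, and one iteration -/

section Explore

variable [Fintype S]

theorem explore_eq : (M.pop d x).explore P d x =
    if (M.settle P d x).h d d.pri x.state = (M.settle P d x).ub d d.pri x.state
    then M.settle P d x else (M.settle P d x).exp P d x := rfl

theorem explore_gmin : (((M.pop d x).explore P d x).search d').gmin =
    ((M.settle P d x).search d').gmin := by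
  rw [explore_eq]
  split_ifs
  · rfl
  · exact exp_gmin

theorem Sound.explore (h : Sound P M) (hx : P.Trail d Set.univ x.state (x.state :: x.anc) x.g)
    (hf : (x.g d.pri : ℝ≥0∞) + M.h d d.pri x.state ≤ M.fbar P d.pri) :
    Sound P ((M.pop d x).explore P d x) := by
  rw [explore_eq]
  split_ifs
  · exact h.settle hx hf
  · exact (h.settle hx hf).exp hx

/-- A child on an optimal path is kept, unless it is weakly dominated. -/
theorem opened_or_covered_exp (h : Sound P M) (he : Exact P C M) (hv : Valid P C M)
    (hC : OptCost P C) {v : S} {b : Fin 2 → ℝ≥0} (ha : P.arc d x.state v)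
    (hs : Split P C d v (x.g + P.arcCost d x.state v) b) :
    Opened C d ((M.exp P d x).search d) v (x.g + P.arcCost d x.state v) ∨
      Covered d ((M.exp P d x).search d) v (x.g + P.arcCost d x.state v) := by
  by_cases hg : (M.search d).gmin v ≤ ((x.g + P.arcCost d x.state v) d.sec : ℝ≥0)
  · right
    unfold Covered
    rwa [exp_gmin]
  · left
    rw [not_le] at hg
    -- Both lower bounds at `v` are valid. This gives the test against the global bounds as well as
    -- the condition on `f_s` in `Opened`.
    have hle : ∀ i, (child P M d x v).f i ≤ C i := by
      intro i
      calc (child P M d x v).f i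
          ≤ ((x.g + P.arcCost d x.state v) i : ℝ≥0) + (b i : ℝ≥0∞) :=
            add_le_add le_rfl (hv.exact_lower he hs i)
        _ = C i := by rw [← hs.sum, ← ENNReal.coe_add, Pi.add_apply _ b]
    refine ⟨child P M d x v, mem_exp.2 (Or.inr ⟨v, ⟨ha, hg, ?_, ?_⟩, rfl⟩), rfl, rfl, hle _⟩
    · intro i
      exact hv.le_ub he h hC hs.symm i
    · intro i
      refine (hle i).trans ?_
      fin_cases i
      · exact hC.le_of_attained h.attained
      · exact ENNReal.coe_le_coe.2 hC.feas.2

/-- If the problem is unsolved after the bounds have been updated, the only part of an optimal path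
that can become newly covered is that of `x` itself. It remains to see that `x` is then not at the
target with cost `C`, and that the continuations of its part are generated or dominated. -/
theorem Optimizing.explore (h : Optimizing P C M) (hC : OptCost P C) (hM : Sound P M)
    (hx : M.IsLeast d x) (hf : x.f d.pri ≤ M.fbar P d.pri)
    (hg : (x.g d.sec : ℝ≥0∞) < (M.search d).gmin x.state) :
    Optimizing P C ((M.pop d x).explore P d x) := by
  have hn := hM.node d x hx.1
  have ht := hn.trail
  rw [hn.f_pri] at hf
  have hexact : Exact P C (M.settle P d x) :=
    h.exact.congr (fun _ => settle_h_pri) (fun _ => settle_ub_sec)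
  have hexact' : Exact P C ((M.pop d x).explore P d x) := by
    rw [explore_eq]
    split_ifs
    exacts [hexact, hexact.congr (fun _ => rfl) (fun _ => rfl)]
  have hsolved : Solved C (M.settle P d x) → Solved C ((M.pop d x).explore P d x) := by
    intro hs
    rw [explore_eq]
    split_ifs
    exacts [hs, hs]
  refine ⟨hexact', ?_⟩
  by_cases hsol : Solved C (M.settle P d x)
  · exact Or.inl (hsolved hsol)
  rcases h.live with hs | ⟨hv, hp⟩
  · exact absurd (hs.settle hC hM ht hf) hsol
  have hv' : Valid P C (M.settle P d x) := hv.settle (hp d) hM h.exact hx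
  have hM' : Sound P (M.settle P d x) := hM.settle ht hf
  refine Or.inr ⟨?_, ?_⟩
  · rw [explore_eq]
    split_ifs
    exacts [hv', hv']
  intro d'
  rcases d.eq_or_opp d' with rfl | rfl
  swap
  · have : ((M.pop d x).explore P d x).search d.opp = M.search d.opp := by
      rw [explore_eq]
      split_ifs
      · exact settle_search_opp
      · rw [exp_search_opp, settle_search_opp]
    rw [this]
    exact hp _
  have hgm : ∀ u, (((M.pop d' x).explore P d' x).search d').gmin u =
      ((M.settle P d' x).search d').gmin u := fun u => by rw [explore_gmin]
  -- New coverage bounds `g_s(x)` by `a`, and extraction order bounds `g_p(x)`; by optimality `g(x)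
  -- = a`.
  have hnew : ∀ u a b, Split P C d' u a b →
      Covered d' (((M.pop d' x).explore P d' x).search d') u a →
      ¬ Covered d' (M.search d') u a → u = x.state ∧ a = x.g := by
    intro u a b hs hc hc'
    unfold Covered at hc
    rw [hgm, settle_gmin] at hc
    split_ifs at hc with hu
    · subst hu
      refine ⟨rfl, (hC.eq_left hs ht.reach fun i => ?_).symm⟩
      rcases d'.eq_pri_or_sec i with rfl | rfl
      · exact (hp d').g_pri_le hM h.exact hx hs hc'
      · exact ENNReal.coe_le_coe.1 hc
    · exact absurd hc hc'
  -- a complementary primary path that is optimal would have solved the problem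
  have hjoin : ∀ b, Split P C d' x.state x.g b →
      ¬ ∀ i, (M.settle P d' x).primary d' x.state i ≤ b i := by
    intro b hs hle
    refine hsol (solved_settle hC hM ht hf fun i => ?_)
    have : (M.settle P d' x).primary d' x.state i = M.primary d' x.state i := by
      rcases d'.eq_pri_or_sec i with rfl | rfl
      · rw [primary_pri, primary_pri, settle_h_pri]
      · rw [primary_sec, primary_sec, settle_ub_sec]
    rw [← this, ← hs.sum, Pi.add_apply, ENNReal.coe_add]
    exact add_le_add le_rfl (hle i)
  refine (hp d').update ?_ ?_ ?_ ?_ hC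
  · intro u
    rw [hgm, settle_gmin]
    split_ifs with hu
    · subst hu
      exact hg.le
    · exact le_rfl
  · intro y hy _
    rcases mem_pop (x := x) hy with rfl | hy
    · right
      unfold Covered
      rw [hgm, settle_gmin, if_pos rfl]
    · left
      rw [← settle_opn (P := P)] at hy
      rw [explore_eq]
      split_ifs
      · exact hy
      · exact mem_exp.2 (Or.inl hy)
  · intro u a b hs hc hc'
    obtain ⟨rfl, rfl⟩ := hnew u a b hs hc hc'
    -- At the target the remaining part costs `0`, so the primary pair is `(0, 0)` and the join with
    -- it would already have solved the problem.
    by_contra! hcon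
    have hs' : Split P C d' x.state x.g 0 := by
      rw [hcon.1, hcon.2]
      exact hC.split_target d'
    refine hjoin 0 hs' fun i => ?_
    have h0 := hexact.le d' _ _ _ hs'
    rcases d'.eq_pri_or_sec i with rfl | rfl
    · rw [primary_pri]
      exact h0
    · rw [primary_sec]
      exact hexact.ub_le d' _ _ _ hs' (le_antisymm h0 (by simp))
  · intro u v a b hu ha hs hc hc'
    have hs' := hs.prev hu ha
    obtain ⟨rfl, rfl⟩ := hnew u a _ hs' hc hc'
    rw [explore_eq]
    split_ifs with heq
    -- Omitting the successors when `h_p = ub_p` is safe: the primary join would be optimal and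
    -- already recorded.
    · exact absurd (hv'.primary_le hexact hM' hC hs' heq) (hjoin _ hs')
    · exact opened_or_covered_exp hM' hexact hv' hC ha hs

theorem Sound.iterate (h : Sound P M) (hx : M.IsLeast d x) (hf : x.f d.pri ≤ M.fbar P d.pri) :
    Sound P (M.iterate P d x) := by
  have hn := h.node d x hx.1
  rw [hn.f_pri] at hf
  simp only [Main.iterate]
  split_ifs
  exacts [h.pop d x, h.pop d x, h.explore hn.trail hf]

theorem Optimizing.iterate (h : Optimizing P C M) (hC : OptCost P C) (hM : Sound P M)
    (hx : M.IsLeast d x) (hf : x.f d.pri ≤ M.fbar P d.pri) :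
    Optimizing P C (M.iterate P d x) := by
  simp only [Main.iterate]
  split_ifs with h1 h2
  -- The stored `f₁` may be stale, but a node that counts as `Opened` was generated with `f₁ ≤ C 0`,
  -- and `C 0` never exceeds the shared bound.
  · refine h.pop hC fun hle => absurd (hle.trans ?_) (not_le.2 h1.2)
    obtain ⟨rfl, -⟩ := h1
    exact hC.le_of_attained hM.attained
  · rw [pop_gmin] at h2
    exact h.pop hC fun _ => h2
  · rw [pop_gmin] at h2
    exact h.explore hC hM hx hf (not_le.1 h2)

end Explore

end Main

/-! ### Existence of an optimal cost -/

section Costs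

variable {S : Type*} (P : Instance S)

/-- The additive monoid generated by the costs of the edges. -/
def costMonoid : AddSubmonoid ℝ≥0 :=
  AddSubmonoid.closure (Set.range fun t : S × S × Fin 2 => P.cost t.1 t.2.1 t.2.2)

variable {P}

theorem arcCost_mem (d : Dir) (u v : S) (i : Fin 2) : P.arcCost d u v i ∈ costMonoid P := by
  cases d
  exacts [AddSubmonoid.subset_closure ⟨(u, v, i), rfl⟩,
    AddSubmonoid.subset_closure ⟨(v, u, i), rfl⟩]

theorem Instance.Reach.mem_costMonoid {d : Dir} {A : Set S} {u : S} {c : Fin 2 → ℝ≥0}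
    (h : P.Reach d A u c) (i : Fin 2) : c i ∈ costMonoid P := by
  obtain ⟨l, t⟩ := h
  induction t with
  | root _ => exact zero_mem _
  | step t ha hv ih => exact add_mem ih (arcCost_mem _ _ _ _)

/-- Finitely many non-negative generators span a partially well-ordered monoid. This yields both the
existence of an optimum and the well-foundedness of `gmin` values. -/
theorem isPWO_costMonoid [Finite S] : (costMonoid P : Set ℝ≥0).IsPWO :=
  Set.IsPWO.addSubmonoid_closure (fun _ _ => zero_le) (Set.finite_range _).isPWO

/-- Minimise `cost₁` first, then `cost₂` among the minimisers; each minimum exists because the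
attained values form a well-founded set. -/
theorem exists_optCost [Finite S] (h : ∃ c, FeasCost P c) : ∃ C, OptCost P C := by
  have hwf : ∀ (i : Fin 2) (s : Set (Fin 2 → ℝ≥0)), (∀ c ∈ s, FeasCost P c) → s.Nonempty →
      ∃ c ∈ s, ∀ c' ∈ s, c i ≤ c' i := by
    intro i s hs hne
    have hw : ((fun c => c i) '' s).IsWF := by
      refine isPWO_costMonoid (P := P) |>.isWF.mono ?_
      rintro _ ⟨c, hc, rfl⟩
      exact (hs c hc).1.mem_costMonoid i
    have hne' := hne.image (fun c => c i)
    obtain ⟨c, hc, hmin⟩ := hw.min_mem hne'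
    refine ⟨c, hc, fun c' hc' => ?_⟩
    dsimp only at hmin
    rw [hmin]
    exact hw.min_le hne' ⟨c', hc', rfl⟩
  obtain ⟨c, hc, hmin⟩ := hwf 0 {c | FeasCost P c} (fun _ h => h) h
  obtain ⟨C, ⟨hC, hC0⟩, hmin'⟩ := hwf 1 {c' | FeasCost P c' ∧ c' 0 = c 0} (fun _ h => h.1)
    ⟨c, hc, rfl⟩
  refine ⟨C, hC, fun c' hc' => ?_⟩
  rcases (hmin c' hc').lt_or_eq with h | h
  · exact Or.inl (hC0 ▸ h)
  · exact Or.inr ⟨hC0.trans h, hmin' c' ⟨hc', h.symm⟩⟩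

theorem Instance.IsFeasible.feasCost {π : List S} (h : P.IsFeasible π) :
    FeasCost P (P.pathCost .fwd π) :=
  ⟨⟨π, Instance.IsPath.trail (d := .fwd) h.1⟩, h.2⟩

theorem Instance.Trail.isFeasible {π : List S} {c : Fin 2 → ℝ≥0}
    (h : P.Trail .bwd Set.univ P.start π c) (hc : c 1 ≤ P.W) :
    P.IsFeasible π ∧ P.pathCost .fwd π = c := by
  obtain ⟨h1, h2⟩ := h.isPath (d := .fwd)
  exact ⟨⟨h1, by rw [h2]; exact hc⟩, h2⟩

theorem exists_feasible_iff : (∃ π, P.IsFeasible π) ↔ ∃ c, FeasCost P c :=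
  ⟨fun ⟨_, h⟩ => ⟨_, h.feasCost⟩, fun ⟨_, ⟨π, h⟩, hc⟩ => ⟨π, (h.isFeasible hc).1⟩⟩

theorem OptCost.isCostOptimal {C : Fin 2 → ℝ≥0} (hC : OptCost P C) {π : List S}
    (h : P.Trail .bwd Set.univ P.start π C) : P.IsCostOptimal π := by
  obtain ⟨h1, h2⟩ := h.isFeasible hC.feas.2
  refine ⟨h1, fun π' h' => ?_⟩
  rw [h2, Prod.Lex.toLex_le_toLex]
  exact hC.least _ h'.feasCost

end Costs

/-! ### Invariants of the algorithm -/

section Algorithm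

variable {S : Type*} {P : Instance S} {e₁ e₂ : S → ℝ≥0}

variable (P e₁ e₂) in
/-- The invariant of round one. -/
structure Round1.Inv (r : Round1 S) : Prop where
  back2 : HSearch.Inv P .bwd 1 Set.univ r.back2
  fwd1 : HSearch.Inv P .fwd 0 Set.univ r.fwd1
  back2_complete : HSearch.Complete P .bwd 1 Set.univ (fun v => (e₂ v : ℝ≥0∞)) P.W r.back2
  fwd1_complete : HSearch.Complete P .fwd 0 Set.univ (fun v => (e₁ v : ℝ≥0∞)) r.fbar1 r.fwd1
  attained : Attained P r.fbar1
  start : P.start ∉ r.back2.closed → r.fbar1 = ⊤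

variable (P) in
/-- The invariant of round two. -/
structure Round2.Inv (R : Round2 S) : Prop where
  back2 : HSearch.Inv P .bwd 1 Set.univ R.r.back2
  fwd1 : HSearch.Inv P .fwd 0 Set.univ R.r.fwd1
  attained : Attained P R.r.fbar1
  allowed : ∀ C, OptCost P C → ∀ d u a b, Split P C d u a b → u ∈ Round2.allowed R.r
  fwd2 : HSearch.Inv P .fwd 1 (Round2.allowed R.r) R.fwd2
  back1 : HSearch.Inv P .bwd 0 (Round2.allowed R.r) R.back1
  fwd2_complete : HSearch.Complete P .fwd 1 (Round2.allowed R.r) (R.r.back2.value 1) P.W R.fwd2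
  back1_complete : HSearch.Complete P .bwd 0 (Round2.allowed R.r) (R.r.fwd1.value 0) R.r.fbar1
    R.back1

variable (P e₁ e₂) in
/-- The invariant of the algorithm. -/
def Config.Inv : Config S → Prop
  | .round1 r => r.Inv P e₁ e₂
  | .round2 R => R.Inv P
  | .main M => Main.Sound P M ∧ ∀ C, OptCost P C → Main.Optimizing P C M
  | .returned out => ((∃ π, P.IsFeasible π) → ∃ π, out.Represents π ∧ P.IsCostOptimal π) ∧
      ((¬ ∃ π, P.IsFeasible π) → out.sol = (none, none))

theorem Instance.IsHeuristic.consistentOn {d : Dir} {i : Fin 2} {e : S → ℝ≥0}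
    (he : P.IsHeuristic d i e) :
    HSearch.ConsistentOn P d i Set.univ (fun v => (e v : ℝ≥0∞)) :=
  ⟨fun _ _ => ENNReal.coe_ne_top, fun u _ v _ h => by exact_mod_cast he.consistent u v h⟩

theorem Instance.IsHeuristic.le {d : Dir} {i : Fin 2} {e : S → ℝ≥0} (he : P.IsHeuristic d i e)
    {u : S} {c : Fin 2 → ℝ≥0} (h : P.Reach d.opp Set.univ u c) : e u ≤ c i := by
  obtain ⟨l, t⟩ := h
  obtain ⟨h1, rfl⟩ := t.isPath
  exact he.admissible u l h1

theorem Round1.Inv.init : Round1.Inv P e₁ e₂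
    ⟨HSearch.init P.goal Set.univ, HSearch.init P.start Set.univ, ⊤⟩ :=
  ⟨HSearch.init_inv (d := .bwd), HSearch.init_inv (d := .fwd), fun h => h.elim, fun h => h.elim,
    fun h => absurd rfl h, fun _ => rfl⟩

theorem Round1.Inv.back2_expand {r : Round1 S} (h : r.Inv P e₁ e₂) (he₂ : P.IsHeuristic .bwd 1 e₂)
    {u : S} {l : Label S} (hu : r.back2.CanExpand 1 (fun v => (e₂ v : ℝ≥0∞)) P.W u l)
    {fbar : ℝ≥0∞} (hs : u = P.start → fbar = l.cost 0) (hs' : u ≠ P.start → fbar = r.fbar1) :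
    Round1.Inv P e₁ e₂
      { r with back2 := r.back2.expand P .bwd 1 Set.univ u l, fbar1 := fbar } := by
  -- The overwriting at `start` is a decrease: before `start` is expanded, the bound is still
  -- infinite.
  have hle : fbar ≤ r.fbar1 := by
    by_cases hus : u = P.start
    · subst hus
      rw [h.start hu.2.1.1.2]
      exact le_top
    · rw [hs' hus]
  refine ⟨h.back2.expand he₂.consistentOn hu.2.1, h.fwd1, HSearch.Complete.expand hu.1 _,
    h.fwd1_complete.mono hle, ?_, fun hn => ?_⟩
  · by_cases hus : u = P.start
    · subst hus
      refine fun _ => ⟨l.cost, ⟨(h.back2.trail _ l hu.2.1.1.1).reach, ?_⟩, hs rfl⟩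
      exact_mod_cast le_self_add.trans hu.2.2
    · rw [hs' hus]
      exact h.attained
  · have : u ≠ P.start := fun hus => hn (Or.inl hus.symm)
    rw [hs' this]
    exact h.start fun hcl => hn (Or.inr hcl)

/-- Round one expands all states on optimal paths. -/
theorem Round1.Inv.mem_allowed {r : Round1 S} (h : r.Inv P e₁ e₂)
    (he₁ : P.IsHeuristic .fwd 0 e₁) (he₂ : P.IsHeuristic .bwd 1 e₂) (hb : r.back2.finished)
    (hf : r.fwd1.finished) {C : Fin 2 → ℝ≥0} (hC : OptCost P C) {u : S} {a b : Fin 2 → ℝ≥0}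
    (hs : Split P C .fwd u a b) : u ∈ Round2.allowed r := by
  constructor
  · refine h.back2_complete hb u b hs.right ?_
    have h1 : e₂ u ≤ a 1 := he₂.le hs.left
    have h2 : b 1 + e₂ u ≤ P.W := by
      calc b 1 + e₂ u ≤ b 1 + a 1 := by gcongr
        _ = C 1 := by rw [← hs.sum, Pi.add_apply, add_comm]
        _ ≤ P.W := hC.feas.2
    dsimp only
    exact_mod_cast h2
  · refine h.fwd1_complete hf u a hs.left (le_trans ?_ (hC.le_of_attained h.attained))
    have h1 : e₁ u ≤ b 0 := he₁.le hs.right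
    have h2 : a 0 + e₁ u ≤ C 0 := by
      calc a 0 + e₁ u ≤ a 0 + b 0 := by gcongr
        _ = C 0 := by rw [← hs.sum, Pi.add_apply]
    dsimp only
    exact_mod_cast h2

theorem Round1.Inv.to_round2 {r : Round1 S} (h : r.Inv P e₁ e₂)
    (he₁ : P.IsHeuristic .fwd 0 e₁) (he₂ : P.IsHeuristic .bwd 1 e₂) (hb : r.back2.finished)
    (hf : r.fwd1.finished) :
    Round2.Inv P ⟨r, HSearch.init P.start (Round2.allowed r),
      HSearch.init P.goal (Round2.allowed r)⟩ := by
  refine ⟨h.back2, h.fwd1, h.attained, fun C hC d u a b hs => ?_, HSearch.init_inv (d := .fwd),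
    HSearch.init_inv (d := .bwd), fun h => h.elim, fun h => h.elim⟩
  cases d with
  | fwd => exact h.mem_allowed he₁ he₂ hb hf hC hs
  | bwd => exact h.mem_allowed he₁ he₂ hb hf hC hs.symm

theorem matching_le (s : HSearch S) (u : S) (l : Label S) (x : ℝ≥0∞) :
    Round2.matching P s u l x ≤ x := by
  unfold Round2.matching
  split_ifs
  exacts [min_le_left _ _, le_rfl]

theorem attained_matching {d : Dir} {p : Fin 2} {A B : Set S} {s : HSearch S}
    (hs : HSearch.Inv P d.opp p A s) {u : S} {l : Label S} (hl : P.Trail d B u l.path l.cost)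
    {x : ℝ≥0∞} (hx : Attained P x) : Attained P (Round2.matching P s u l x) := by
  unfold Round2.matching
  split_ifs with hW
  · have hne : s.value 1 u ≠ ⊤ := fun h => by simp [h] at hW
    obtain ⟨b, hb, hv, -⟩ := hs.value_eq (hs.value_ne_top hne).1
    rcases min_choice x ((l.cost 0 : ℝ≥0∞) + s.value 0 u) with h | h
    · rwa [h]
    · rw [h]
      rw [hv] at hW
      exact fun _ => ⟨l.cost + b, ⟨hl.reach.univ.join hb.reach.univ, by exact_mod_cast hW⟩,
        by simp [hv]⟩
  · exact hx

theorem Round2.Inv.fwd2_heuristic {R : Round2 S} (h : R.Inv P) :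
    HSearch.ConsistentOn P .fwd 1 (Round2.allowed R.r) (R.r.back2.value 1) :=
  HSearch.Inv.consistentOn (d := .fwd) h.back2 Set.inter_subset_left (Set.subset_univ _)

theorem Round2.Inv.back1_heuristic {R : Round2 S} (h : R.Inv P) :
    HSearch.ConsistentOn P .bwd 0 (Round2.allowed R.r) (R.r.fwd1.value 0) :=
  HSearch.Inv.consistentOn (d := .bwd) h.fwd1 Set.inter_subset_right (Set.subset_univ _)

theorem Round2.Inv.fwd2_expand {R : Round2 S} (h : R.Inv P) {u : S} {l : Label S}
    (hu : R.fwd2.CanExpand 1 (R.r.back2.value 1) P.W u l) :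
    Round2.Inv P { R with
          r := { R.r with fbar1 := Round2.matching P R.r.back2 u l R.r.fbar1 }
          fwd2 := R.fwd2.expand P .fwd 1 (Round2.allowed R.r) u l } :=
  ⟨h.back2, h.fwd1,
    attained_matching (d := .fwd) h.back2 (h.fwd2.trail u l hu.2.1.1.1) h.attained, h.allowed,
    h.fwd2.expand h.fwd2_heuristic hu.2.1, h.back1, HSearch.Complete.expand hu.1 _,
    h.back1_complete.mono (matching_le _ _ _ _)⟩

theorem Round2.Inv.back1_expand {R : Round2 S} (h : R.Inv P) {u : S} {l : Label S}
    (hu : R.back1.CanExpand 0 (R.r.fwd1.value 0) R.r.fbar1 u l) :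
    Round2.Inv P { R with
          r := { R.r with fbar1 := Round2.matching P R.r.fwd1 u l R.r.fbar1 }
          back1 := R.back1.expand P .bwd 0 (Round2.allowed R.r) u l } :=
  ⟨h.back2, h.fwd1,
    attained_matching (d := .bwd) h.fwd1 (h.back1.trail u l hu.2.1.1.1) h.attained, h.allowed,
    h.fwd2, h.back1.expand h.back1_heuristic hu.2.1, h.fwd2_complete,
    HSearch.Complete.expand hu.1 _⟩

/-! ### The beginning of the constrained search -/

/-- The search of the initialisation which provides the primary bounds of a direction. -/
def Round2.primarySearch (R : Round2 S) : Dir → HSearch S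
  | .fwd => R.back1
  | .bwd => R.fwd2

/-- The search of the initialisation which provides the secondary bounds of a direction. -/
def Round2.secondarySearch (R : Round2 S) : Dir → HSearch S
  | .fwd => R.r.back2
  | .bwd => R.r.fwd1

theorem Main.init_primary (R : Round2 S) (d : Dir) (u : S) (i : Fin 2) :
    (Main.init P R).primary d u i = (R.primarySearch d).value i u := by
  cases d <;> fin_cases i <;> rfl

theorem Main.init_secondary (R : Round2 S) (d : Dir) (u : S) (i : Fin 2) :
    (Main.init P R).secondary d u i = (R.secondarySearch d).value i u := by
  cases d <;> fin_cases i <;> rfl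

theorem Main.init_comp (R : Round2 S) (d : Dir) (u : S) :
    (Main.init P R).comp d u = (R.primarySearch d).route u := by
  cases d <;> rfl

theorem Dir.other_pri (d : Dir) : other d.pri = d.sec := by cases d <;> rfl

theorem Round2.Inv.primarySearch {R : Round2 S} (h : R.Inv P) (d : Dir) :
    HSearch.Inv P d.opp d.pri (Round2.allowed R.r) (R.primarySearch d) := by
  cases d
  exacts [h.back1, h.fwd2]

theorem Round2.Inv.secondarySearch {R : Round2 S} (h : R.Inv P) (d : Dir) :
    HSearch.Inv P d.opp d.sec Set.univ (R.secondarySearch d) := by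
  cases d
  exacts [h.back2, h.fwd1]

/-- Every state along the prefix lies on the same optimal path, so the prefix never leaves `A`. -/
theorem reach_allowed {A : Set S} {C : Fin 2 → ℝ≥0} {d : Dir}
    (hA : ∀ u a b, Split P C d u a b → u ∈ A) {u : S} {a b : Fin 2 → ℝ≥0}
    (hs : Split P C d u a b) : P.Reach d A u a := by
  obtain ⟨l, t⟩ := hs.left
  induction t generalizing b with
  | root _ => exact .root (hA _ _ _ hs)
  | step t ha hv ih => exact (ih (hs.prev t.reach ha)).step ha (hA _ _ _ hs)

/-- The heuristic of round two is the round-one optimum for the other half of the path, hence at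
most `a` in the relevant attribute. The estimate of `u` along the optimal path is then at most `C`,
so within the bound of the search. -/
theorem Round2.Inv.mem_closed {R : Round2 S} (h : R.Inv P) (hf : R.fwd2.finished)
    (hb : R.back1.finished) {C : Fin 2 → ℝ≥0} (hC : OptCost P C) {d : Dir} {u : S}
    {a b : Fin 2 → ℝ≥0} (hs : Split P C d u a b) : u ∈ (R.primarySearch d).closed := by
  have key : ∀ p {x : ℝ≥0∞}, x ≤ a p → (b p : ℝ≥0∞) + x ≤ C p := by
    intro p x hle
    calc (b p : ℝ≥0∞) + x ≤ b p + a p := by gcongr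
      _ = C p := by rw [← hs.sum, Pi.add_apply, ENNReal.coe_add, add_comm]
  have hal := h.allowed C hC d u a b hs
  have hr : P.Reach d.opp (Round2.allowed R.r) u b :=
    reach_allowed (fun u a b => h.allowed C hC d.opp u a b) hs.symm
  cases d with
  | fwd =>
    obtain ⟨c, -, hc, hle⟩ := h.fwd1.value_eq hal.2
    refine h.back1_complete hb u b hr (le_trans ?_ (hC.le_of_attained h.attained))
    refine key 0 ?_
    rw [hc]
    exact_mod_cast (hle a hs.left).pri
  | bwd =>
    obtain ⟨c, -, hc, hle⟩ := h.back2.value_eq hal.1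
    refine h.fwd2_complete hf u b hr (le_trans ?_ (ENNReal.coe_le_coe.2 hC.feas.2))
    refine key 1 ?_
    rw [hc]
    exact_mod_cast (hle a hs.left).pri

theorem Round2.Inv.sound_init {R : Round2 S} (h : R.Inv P) : Main.Sound P (Main.init P R) where
  node d x hx := by
    simp only [Main.init, Multiset.mem_singleton] at hx
    subst hx
    exact ⟨.root (Set.mem_univ _), by simp [Main.init]⟩
  gmin d u := Or.inl rfl
  primary d u i hi := by
    simp only [Main.init_primary, Main.init_comp] at hi ⊢
    obtain ⟨b, hb, hv, -⟩ :=
      (h.primarySearch d).value_eq ((h.primarySearch d).value_ne_top hi).1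
    exact ⟨b, hb.mono (Set.subset_univ _), hv⟩
  secondary d u i hi := by
    simp only [Main.init_secondary] at hi ⊢
    obtain ⟨b, hb, hv, -⟩ :=
      (h.secondarySearch d).value_eq ((h.secondarySearch d).value_ne_top hi).1
    exact ⟨b, hb.reach, hv⟩
  attained := h.attained
  sol hn := absurd rfl hn
  exists_feas hn := absurd rfl hn

/-- Round two expands all states on optimal paths, which makes the primary pairs exact there; round
one supplies the secondary lower bounds. Nothing is covered yet, and the initial node is the open
part of cost `0`. -/
theorem Round2.Inv.optimizing_init {R : Round2 S} (h : R.Inv P) (hf : R.fwd2.finished)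
    (hb : R.back1.finished) {C : Fin 2 → ℝ≥0} (hC : OptCost P C) :
    Main.Optimizing P C (Main.init P R) := by
  have hpri : ∀ d u, (Main.init P R).h d d.pri u = (R.primarySearch d).value d.pri u :=
    fun d u => by rw [← Main.init_primary (P := P), Main.primary_pri]
  have hsec : ∀ d u, (Main.init P R).ub d d.sec u = (R.primarySearch d).value d.sec u :=
    fun d u => by rw [← Main.init_primary (P := P), Main.primary_sec]
  have hsec' : ∀ d u, (Main.init P R).h d d.sec u = (R.secondarySearch d).value d.sec u :=
    fun d u => by rw [← Main.init_secondary (P := P), Main.secondary_sec]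
  have hlex : ∀ d u a b, Split P C d u a b → ∃ c : Fin 2 → ℝ≥0,
      (∀ i, (R.primarySearch d).value i u = c i) ∧ LexLE d.pri c b := by
    intro d u a b hs
    obtain ⟨c, -, hc, hle⟩ := (h.primarySearch d).value_eq (h.mem_closed hf hb hC hs)
    exact ⟨c, hc, hle b (reach_allowed (fun u a b => h.allowed C hC d.opp u a b) hs.symm)⟩
  have hexact : Main.Exact P C (Main.init P R) := by
    constructor
    · intro d u a b hs
      obtain ⟨c, hc, hle⟩ := hlex d u a b hs
      rw [hpri, hc]
      exact_mod_cast hle.pri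
    · intro d u a b hs heq
      obtain ⟨c, hc, hle⟩ := hlex d u a b hs
      rw [hpri, hc] at heq
      rw [hsec, hc]
      norm_cast at heq ⊢
      rcases hle with hlt | ⟨-, hle⟩
      · exact absurd heq hlt.ne
      · rwa [Dir.other_pri] at hle
    · intro d u v a b a' b' hs hs' ha
      rw [hpri, hpri]
      exact (h.primarySearch d).value_le_add (h.mem_closed hf hb hC hs)
        (h.mem_closed hf hb hC hs') (h.allowed C hC d u a b hs) ha
  have hvalid : Main.Valid P C (Main.init P R) := by
    intro d u a b hs
    rw [hsec']
    have hcl : u ∈ (R.secondarySearch d).closed := by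
      have := h.allowed C hC d u a b hs
      cases d
      exacts [this.1, this.2]
    obtain ⟨c, -, hc, hle⟩ := (h.secondarySearch d).value_eq hcl
    rw [hc]
    exact_mod_cast (hle b hs.right).pri
  refine ⟨hexact, Or.inr ⟨hvalid, fun d => ⟨Or.inl ?_, fun u v a b _ _ _ hc => ?_, ?_⟩⟩⟩
  · exact ⟨_, Multiset.mem_singleton_self _, rfl, rfl, hvalid d _ _ _ (hC.split_initial d)⟩
  · exact absurd hc (by simp [Main.Covered, Main.init])
  · simp [Main.Covered, Main.init]

/-- The result is correct whenever a search that is not solved cannot have stopped. -/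
theorem returned_inv [Finite S] {M : Main S} (hM : Main.Sound P M)
    (hO : ∀ C, OptCost P C → Main.Optimizing P C M) {d : Dir}
    (hout : ∀ y ∈ (M.search d).opn, ¬ y.f d.pri ≤ M.fbar P d.pri) :
    Config.Inv P e₁ e₂ (.returned M.toOutput) := by
  refine ⟨fun hfeas => ?_, fun hn => ?_⟩
  · obtain ⟨C, hC⟩ := exists_optCost (exists_feasible_iff.1 hfeas)
    rcases (hO C hC).live with hs | ⟨-, hp⟩
    · obtain ⟨π, c, hπ, ht, h0, h1, -⟩ := hM.sol (by rw [hs.2]; exact ENNReal.coe_ne_top)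
      rw [hs.1] at h0
      rw [hs.2] at h1
      have : c = C := by
        ext i
        fin_cases i
        · simpa using h0.symm
        · simpa using h1.symm
      subst this
      exact ⟨π, hπ, hC.isCostOptimal ht⟩
    · obtain ⟨y, hy, hf⟩ := (hp d).exists_open hM (hO C hC).exact hC
      exact absurd hf (hout y hy)
  · by_contra hsol
    exact hn (exists_feasible_iff.2 (hM.exists_feas hsol))

theorem Step.inv [Fintype S] (he₁ : P.IsHeuristic .fwd 0 e₁) (he₂ : P.IsHeuristic .bwd 1 e₂)
    {c c' : Config S} (hc : c.Inv P e₁ e₂) (hs : Step P e₁ e₂ c c') : c'.Inv P e₁ e₂ := by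
  cases hs with
  | back2_expand r u l hu =>
    exact Round1.Inv.back2_expand hc he₂ hu (fun h => if_pos h) (fun h => if_neg h)
  | back2_finish r hr =>
    replace hc : r.Inv P e₁ e₂ := hc
    exact ⟨hc.back2.finish, hc.fwd1, hc.back2.complete_finish he₂.consistentOn hr,
      hc.fwd1_complete, hc.attained, hc.start⟩
  | fwd1_expand r u l hu =>
    replace hc : r.Inv P e₁ e₂ := hc
    exact ⟨hc.back2, hc.fwd1.expand he₁.consistentOn hu.2.1, hc.back2_complete,
      HSearch.Complete.expand hu.1 _, hc.attained, hc.start⟩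
  | fwd1_finish r hr =>
    replace hc : r.Inv P e₁ e₂ := hc
    exact ⟨hc.back2, hc.fwd1.finish, hc.back2_complete,
      hc.fwd1.complete_finish he₁.consistentOn hr, hc.attained, hc.start⟩
  | to_round2 r hb hf => exact Round1.Inv.to_round2 hc he₁ he₂ hb hf
  | fwd2_expand R u l hu => exact Round2.Inv.fwd2_expand hc hu
  | fwd2_finish R hR =>
    replace hc : R.Inv P := hc
    exact ⟨hc.back2, hc.fwd1, hc.attained, hc.allowed, hc.fwd2.finish, hc.back1,
      hc.fwd2.complete_finish hc.fwd2_heuristic hR, hc.back1_complete⟩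
  | back1_expand R u l hu => exact Round2.Inv.back1_expand hc hu
  | back1_finish R hR =>
    replace hc : R.Inv P := hc
    exact ⟨hc.back2, hc.fwd1, hc.attained, hc.allowed, hc.fwd2, hc.back1.finish,
      hc.fwd2_complete, hc.back1.complete_finish hc.back1_heuristic hR⟩
  | to_main R hf hb =>
    replace hc : R.Inv P := hc
    exact ⟨hc.sound_init, fun C hC => hc.optimizing_init hf hb hC⟩
  | iterate M d x hx hf =>
    exact ⟨hc.1.iterate hx hf, fun C hC => (hc.2 C hC).iterate hC hc.1 hx hf⟩
  | stop_bound M d x hx hf =>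
    exact returned_inv hc.1 hc.2 fun y hy =>
      not_le.2 (hf.trans_le (fst_le_of_toLex_le (hx.2 y hy)))
  | stop_empty M d ho => exact returned_inv hc.1 hc.2 (d := d) fun y hy => by simp [ho] at hy

theorem Reachable.inv [Fintype S] (he₁ : P.IsHeuristic .fwd 0 e₁)
    (he₂ : P.IsHeuristic .bwd 1 e₂) {c : Config S} (h : Reachable P e₁ e₂ c) :
    c.Inv P e₁ e₂ := by
  induction h with
  | refl => exact Round1.Inv.init
  | tail _ hs ih => exact hs.inv he₁ he₂ ih

end Algorithm

/-! ### Termination -/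

section Termination

variable {S : Type*} {P : Instance S} {e₁ e₂ : S → ℝ≥0}

instance : Finite Dir :=
  Finite.of_surjective (fun b : Bool => if b then Dir.fwd else Dir.bwd) fun d => by
    cases d
    exacts [⟨true, rfl⟩, ⟨false, rfl⟩]

variable (P) in
/-- The possible values of `g_min`. -/
def gminValues : Set ℝ≥0∞ := insert ⊤ ((fun x : ℝ≥0 => (x : ℝ≥0∞)) '' costMonoid P)

instance [Finite S] : WellFoundedLT (gminValues P) :=
  ⟨((isPWO_costMonoid (P := P)).image_of_monotone ENNReal.coe_mono |>.insert ⊤).isWF⟩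

theorem Main.Sound.gmin_mem {M : Main S} (h : Main.Sound P M) (d : Dir) (u : S) :
    (M.search d).gmin u ∈ gminValues P := by
  rcases h.gmin d u with h | ⟨a, ha, h⟩
  · exact Or.inl h
  · exact Or.inr ⟨_, ha.mem_costMonoid _, h.symm⟩

open scoped Classical in
variable (P) in
/-- Restriction to the possible values of `g_min`. -/
def toGminValue (x : ℝ≥0∞) : gminValues P :=
  if h : x ∈ gminValues P then ⟨x, h⟩ else ⟨⊤, Or.inl rfl⟩

/-- The rank is defined on all configurations, so impossible values are sent to `⊤`; by soundness
this default never matters in the comparisons. -/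
theorem toGminValue_le {x y : ℝ≥0∞} (hx : x ∈ gminValues P) (hy : y ∈ gminValues P)
    (h : x ≤ y) : toGminValue P x ≤ toGminValue P y := by
  simpa [toGminValue, hx, hy] using h

theorem toGminValue_lt {x y : ℝ≥0∞} (hx : x ∈ gminValues P) (hy : y ∈ gminValues P)
    (h : x < y) : toGminValue P x < toGminValue P y := by
  simpa [toGminValue, hx, hy] using h

open scoped Classical in
/-- The number of iterations a bounded A* can still make. -/
def HSearch.remaining (s : HSearch S) : ℕ := s.closedᶜ.ncard + if s.finished then 0 else 1

theorem HSearch.remaining_expand [Finite S] {s : HSearch S} {d : Dir} {p : Fin 2} {A : Set S}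
    {u : S} {l : Label S} (hu : u ∉ s.closed) :
    (s.expand P d p A u l).remaining < s.remaining := by
  have : (insert u s.closed)ᶜ.ncard < s.closedᶜ.ncard := by
    refine Set.ncard_lt_ncard ⟨Set.compl_subset_compl.2 (Set.subset_insert _ _), fun h => ?_⟩
      (Set.toFinite _)
    exact h hu (Set.mem_insert _ _)
  exact Nat.add_lt_add_right this _

theorem HSearch.remaining_finish {s : HSearch S} (hs : ¬ s.finished) :
    s.finish.remaining < s.remaining := by
  simp [remaining, finish, hs]

variable (P) in
/-- A measure which every step of the algorithm decreases. -/
def Config.rank : Config S → ℕ ×ₗ (Dir → S → gminValues P) ×ₗ ℕ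
  | .round1 r => toLex (3, toLex (fun _ _ => toGminValue P ⊤,
      r.back2.remaining + r.fwd1.remaining))
  | .round2 R => toLex (2, toLex (fun _ _ => toGminValue P ⊤,
      R.fwd2.remaining + R.back1.remaining))
  | .main M => toLex (1, toLex (fun d u => toGminValue P ((M.search d).gmin u),
      (M.search .fwd).opn.card + (M.search .bwd).opn.card))
  | .returned _ => toLex (0, toLex (fun _ _ => toGminValue P ⊤, 0))

theorem toLex_lt_toLex_snd {α β γ : Type*} [LT α] [LT β] [LT γ] (a : α) (b : β) {n m : γ}
    (h : n < m) : toLex (a, toLex (b, n)) < toLex (a, toLex (b, m)) :=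
  Prod.Lex.toLex_lt_toLex.2 (Or.inr ⟨rfl, Prod.Lex.toLex_lt_toLex.2 (Or.inr ⟨rfl, h⟩)⟩)

theorem Main.card_pop {M : Main S} {d : Dir} {x : Node S} (hx : x ∈ (M.search d).opn) :
    (((M.pop d x).search .fwd).opn.card + ((M.pop d x).search .bwd).opn.card) <
      (M.search .fwd).opn.card + (M.search .bwd).opn.card := by
  classical
  have := Multiset.card_erase_lt_of_mem hx
  cases d
  · simpa [pop] using this
  · simpa [pop] using this

theorem Main.gmin_explore [Fintype S] {M : Main S} {d : Dir} {x : Node S} (d' : Dir) (u : S)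
    (h : (x.g d.sec : ℝ≥0∞) < (M.search d).gmin x.state) :
    (((M.pop d x).explore P d x).search d').gmin u ≤ (M.search d').gmin u := by
  rw [explore_gmin]
  rcases d.eq_or_opp d' with rfl | rfl
  · rw [settle_gmin]
    split_ifs with hu
    · subst hu
      exact h.le
    · exact le_rfl
  · rw [settle_search_opp]

/-- A discarded node shrinks a queue and leaves `gmin` unchanged. An explored node may enlarge the
queue, but it strictly lowers `gmin` at its state, which has priority in the rank. -/
theorem Main.rank_iterate [Fintype S] {M : Main S} {d : Dir} {x : Node S} (h : Main.Sound P M)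
    (hx : M.IsLeast d x) (hf : x.f d.pri ≤ M.fbar P d.pri) :
    Config.rank P (.main (M.iterate P d x)) < Config.rank P (.main M) := by
  have hpop : Config.rank P (.main (M.pop d x)) < Config.rank P (.main M) := by
    simp only [Config.rank, pop_gmin]
    exact toLex_lt_toLex_snd _ _ (card_pop hx.1)
  have hs := h.iterate hx hf
  simp only [Main.iterate] at hs ⊢
  split_ifs at hs ⊢ with h1 h2
  · exact hpop
  · exact hpop
  · rw [pop_gmin, not_le] at h2
    refine Prod.Lex.toLex_lt_toLex.2 (Or.inr ⟨rfl, Prod.Lex.toLex_lt_toLex.2 (Or.inl ?_)⟩)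
    have hle : ∀ d' u, toGminValue P ((((M.pop d x).explore P d x).search d').gmin u) ≤
        toGminValue P ((M.search d').gmin u) := fun d' u =>
      toGminValue_le (hs.gmin_mem d' u) (h.gmin_mem d' u) (gmin_explore d' u h2)
    refine Pi.lt_def.2 ⟨fun d' u => hle d' u, d, Pi.lt_def.2 ⟨hle d, x.state, ?_⟩⟩
    refine toGminValue_lt (hs.gmin_mem d _) (h.gmin_mem d _) ?_
    rwa [explore_gmin, settle_gmin, if_pos rfl]

theorem Step.rank_lt [Fintype S] {c c' : Config S} (hc : c.Inv P e₁ e₂)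
    (hs : Step P e₁ e₂ c c') : c'.rank P < c.rank P := by
  have hphase : ∀ {m n : ℕ} (x y : (Dir → S → gminValues P) ×ₗ ℕ), m < n →
      toLex (m, x) < toLex (n, y) := fun x y h => Prod.Lex.toLex_lt_toLex.2 (Or.inl h)
  cases hs with
  | back2_expand r u l hu =>
    exact toLex_lt_toLex_snd _ _
      (add_lt_add_left (HSearch.remaining_expand hu.2.1.1.2) _)
  | back2_finish r hr =>
    exact toLex_lt_toLex_snd _ _ (add_lt_add_left (HSearch.remaining_finish hr.1) _)
  | fwd1_expand r u l hu =>
    exact toLex_lt_toLex_snd _ _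
      (add_lt_add_right (HSearch.remaining_expand hu.2.1.1.2) _)
  | fwd1_finish r hr =>
    exact toLex_lt_toLex_snd _ _ (add_lt_add_right (HSearch.remaining_finish hr.1) _)
  | to_round2 r hb hf => exact hphase _ _ (by norm_num)
  | fwd2_expand R u l hu =>
    exact toLex_lt_toLex_snd _ _
      (add_lt_add_left (HSearch.remaining_expand hu.2.1.1.2) _)
  | fwd2_finish R hR =>
    exact toLex_lt_toLex_snd _ _ (add_lt_add_left (HSearch.remaining_finish hR.1) _)
  | back1_expand R u l hu =>
    exact toLex_lt_toLex_snd _ _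
      (add_lt_add_right (HSearch.remaining_expand hu.2.1.1.2) _)
  | back1_finish R hR =>
    exact toLex_lt_toLex_snd _ _ (add_lt_add_right (HSearch.remaining_finish hR.1) _)
  | to_main R hf hb => exact hphase _ _ (by norm_num)
  | iterate M d x hx hf => exact Main.rank_iterate hc.1 hx hf
  | stop_bound M d x hx hf => exact hphase _ _ (by norm_num)
  | stop_empty M d ho => exact hphase _ _ (by norm_num)

end Termination

/-! ### Progress -/

section Liveness

variable {S : Type*} {P : Instance S} {e₁ e₂ : S → ℝ≥0}

/-- A running bounded A* can make an iteration. -/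
theorem HSearch.canExpand_or_canFinish [Finite S] {s : HSearch S} (hs : ¬ s.finished)
    (p : Fin 2) (e : S → ℝ≥0∞) (bound : ℝ≥0∞) :
    (∃ u l, s.CanExpand p e bound u l) ∨ s.CanFinish p e bound := by
  by_cases ho : ∃ u l, s.IsOpen u l
  · obtain ⟨u, ⟨l, hl⟩, hmin⟩ := Set.exists_min_image {u | ∃ l, s.IsOpen u l}
      (fun u => (s.label u).elim (toLex (0, 0)) (key p e u)) (Set.toFinite _) ho
    have hleast : s.IsLeast p e u l := by
      refine ⟨hl, fun u' l' hl' => ?_⟩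
      simpa [hl.1, hl'.1] using hmin u' ⟨l', hl'⟩
    by_cases hb : (l.cost p : ℝ≥0∞) + e u ≤ bound
    · exact Or.inl ⟨u, l, hs, hleast, hb⟩
    · exact Or.inr ⟨hs, Or.inr ⟨u, l, hleast, not_le.1 hb⟩⟩
  · push Not at ho
    exact Or.inr ⟨hs, Or.inl ho⟩

theorem Main.exists_isLeast {M : Main S} {d : Dir} (h : (M.search d).opn ≠ 0) :
    ∃ x, M.IsLeast d x := by
  classical
  obtain ⟨x, hx⟩ := Multiset.exists_mem_of_ne_zero h
  obtain ⟨y, hy, hmin⟩ := (M.search d).opn.toFinset.exists_min_image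
    (fun y => toLex (y.f d.pri, y.f d.sec)) ⟨x, Multiset.mem_toFinset.2 hx⟩
  exact ⟨y, Multiset.mem_toFinset.1 hy, fun z hz => hmin z (Multiset.mem_toFinset.2 hz)⟩

/-- Only configurations that have returned a result are final. -/
theorem exists_step [Fintype S] (P : Instance S) (e₁ e₂ : S → ℝ≥0) (c : Config S) :
    (∃ out, c = .returned out) ∨ ∃ c', Step P e₁ e₂ c c' := by
  cases c with
  | round1 r =>
    right
    by_cases hb : r.back2.finished
    · by_cases hf : r.fwd1.finished
      · exact ⟨_, .to_round2 r hb hf⟩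
      · rcases HSearch.canExpand_or_canFinish hf _ _ _ with ⟨u, l, h⟩ | h
        exacts [⟨_, .fwd1_expand r u l h⟩, ⟨_, .fwd1_finish r h⟩]
    · rcases HSearch.canExpand_or_canFinish hb _ _ _ with ⟨u, l, h⟩ | h
      exacts [⟨_, .back2_expand r u l h⟩, ⟨_, .back2_finish r h⟩]
  | round2 R =>
    right
    by_cases hf : R.fwd2.finished
    · by_cases hb : R.back1.finished
      · exact ⟨_, .to_main R hf hb⟩
      · rcases HSearch.canExpand_or_canFinish hb _ _ _ with ⟨u, l, h⟩ | h
        exacts [⟨_, .back1_expand R u l h⟩, ⟨_, .back1_finish R h⟩]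
    · rcases HSearch.canExpand_or_canFinish hf _ _ _ with ⟨u, l, h⟩ | h
      exacts [⟨_, .fwd2_expand R u l h⟩, ⟨_, .fwd2_finish R h⟩]
  | main M =>
    right
    by_cases ho : (M.search .fwd).opn = 0
    · exact ⟨_, .stop_empty M .fwd ho⟩
    · obtain ⟨x, hx⟩ := Main.exists_isLeast ho
      by_cases hf : x.f Dir.fwd.pri ≤ M.fbar P Dir.fwd.pri
      · exact ⟨_, .iterate M .fwd x hx hf⟩
      · exact ⟨_, .stop_bound M .fwd x hx (not_le.1 hf)⟩
  | returned out => exact Or.inl ⟨out, rfl⟩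

end Liveness

end WCSPP

end

/-- The absence of infinite runs, together with the absence of deadlocks before a result, means that
every maximal run ends with an output, whatever the interleaving and the choices among ties. -/
theorem mainTheorem4 {S : Type*} [Fintype S] (P : WCSPP.Instance S) (e₁ e₂ : S → ℝ≥0)
    (he₁ : P.IsHeuristic .fwd 0 e₁) (he₂ : P.IsHeuristic .bwd 1 e₂) :
    (¬ ∃ run : ℕ → WCSPP.Config S, run 0 = WCSPP.initConfig P ∧
      ∀ n, WCSPP.Step P e₁ e₂ (run n) (run (n + 1))) ∧
    (∀ c, WCSPP.Reachable P e₁ e₂ c →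
      (∃ out, c = .returned out) ∨ ∃ c', WCSPP.Step P e₁ e₂ c c') ∧
    (∀ out, WCSPP.Reachable P e₁ e₂ (.returned out) →
      ((∃ π, P.IsFeasible π) → ∃ π, out.Represents π ∧ P.IsCostOptimal π) ∧
      ((¬ ∃ π, P.IsFeasible π) → out.sol = (none, none))) := by
  refine ⟨?_, fun c _ => WCSPP.exists_step P e₁ e₂ c, fun out h => h.inv he₁ he₂⟩
  rintro ⟨run, h0, hstep⟩
  have hreach : ∀ n, WCSPP.Reachable P e₁ e₂ (run n) := by
    intro n
    induction n with
    | zero => rw [h0]; exact .refl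
    | succ n ih => exact ih.tail (hstep n)
  -- An infinite run would give an infinite descending chain of ranks. The invariant along the run
  -- is needed, since the rank is only known to drop from configurations that satisfy it.
  exact (wellFounded_iff_isEmpty_descending_chain.1 (wellFounded_lt
    (α := ℕ ×ₗ (WCSPP.Dir → S → WCSPP.gminValues P) ×ₗ ℕ))).false
    ⟨fun n => (run n).rank P, fun n =>
      ((hstep n).rank_lt ((hreach n).inv he₁ he₂))⟩
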